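/- **Setting.** All alphabets are finite. The source and side-information letters $(S_{1,k},S_{2,k},W_k,W_{3,k})$ are i.i.d. in $k$ with law $p(s_1,s_2,w,w_3)$. A memoryless multiple-access relay channel $p(y,y_3|x_1,x_2,x_3)$ is given. A code of blocklength $n$ consists of encoders $f_i:\mathcal S_i^n\to\mathcal X_i^n$ ($i=1,2$), causal relay maps $x_{3,k}=f_{3,k}(y_3^{k-1},w_3^n)$ ($k=1,\dots,n$), and a decoder $g:\mathcal Y^n\times\mathcal W^n\to\mathcal S_1^n\times\mathcal S_2^n$. The pair $(S_1,S_2)$ is *reliably transmissible* if there is a sequence of codes with $\Pr\big(g(Y^n,W^n)\ne(S_1^n,S_2^n)\big)\to0$. Entropies and mutual informations are in bits. **Definitions.** For a pair $(X,Y)$, the maximal correlation is $\rho^*_{XY}=\sup \mathbb E[f(X)g(Y)]$ over real $f,g$ with $\mathbb E f(X)=\mathbb E g(Y)=0$ and $\mathbb E f(X)^2=\mathbb E g(Y)^2=1$ (and $\sup\emptyset=0$); $\rho^*_{XY|z}$ is the same quantity for the conditional law given $z$. Let $\mathcal B$ be the set of conditional p.m.f.s $p(x_1,x_2|s_1,s_2)$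 for which there are an integer $n\ge1$ and conditional p.m.f.s $p(x_1|s_1^n)$, $p(x_2|s_2^n)$ such that, for all $x_1,x_2$ and all $(s_{1,1},s_{2,1})$ of positive probability, $$p(x_1,x_2|s_{1,1},s_{2,1})=\frac1{p(s_{1,1},s_{2,1})}\sum_{s_{1,2}^n,\,s_{2,2}^n}p(x_1|s_1^n)\,p(x_2|s_2^n)\prod_{k=1}^np(s_{1,k},s_{2,k}).$$ Let $\overline{\mathcal B}$ be its closure (entrywise convergence). Let $\mathcal B'$ be the set of conditional p.m.f.s $p(x_1,x_2|s_1,s_2)$ for which $\rho^*_{X_1X_2}$, $\rho^*_{X_1X_2|s_1}$, $\rho^*_{X_1X_2|s_2}$ and $\rho^*_{X_1X_2|s_1,s_2}$ are all at most $\rho^*_{S_1S_2}$, for all values $s_1$, $s_2$, $(s_1,s_2)$ of positive probability. **Theorem.** One has $\mathcal B\subseteq\mathcal B'$ and $\overline{\mathcal B}\subseteq\mathcal B'$. If $(S_1,S_2)$ is reliably transmissible, then the following hold. (a) There is a joint distribution $$p(q)\,p(s_1,s_2,w)\,p(x_1,x_2|s_1,s_2,q)\,p(x_3|x_1,x_2,s_1,s_2,q)\,p(y|x_1,x_2,x_3)$$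 with $|\mathcal Q|\le4$ and $p(\cdot,\cdot|\cdot,\cdot,q)\in\overline{\mathcal B}\subseteq\mathcal B'$ for every $q\in\mathcal Q$, such that $$H(S_1|S_2,W)\le I(X_1,X_3;Y|S_2,X_2,W,Q),$$ $$H(S_2|S_1,W)\le I(X_2,X_3;Y|S_1,X_1,W,Q),$$ $$H(S_1,S_2|W)\le I(X_1,X_2,X_3;Y|W,Q).$$ (b) For every $\varepsilon>0$ there is a joint distribution of the same form with $|\mathcal Q|\le4$ and $p(\cdot,\cdot|\cdot,\cdot,q)\in\mathcal B\subseteq\mathcal B'$ for every $q\in\mathcal Q$, for which the three inequalities hold with $\varepsilon$ added to each right-hand side. -/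

import Mathlib

open scoped Topology

namespace MARC

noncomputable section

/-! Probability mass functions on a finite alphabet `α` are elements of `stdSimplex ℝ α`;
conditional p.m.f.s are families of such elements. -/

/-- The p.m.f. of the random variable `X` on the finite sample space `Ω` with p.m.f. `μ`. -/
def law {Ω α : Type*} [Fintype Ω] (μ : Ω → ℝ) (X : Ω → α) (a : α) : ℝ :=
  open Classical in ∑ ω, if X ω = a then μ ω else 0

/-- Shannon entropy `H(X)` in bits. -/
def entropy {Ω α : Type*} [Fintype Ω] [Fintype α] (μ : Ω → ℝ) (X : Ω → α) : ℝ :=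
  (∑ a, Real.negMulLog (law μ X a)) / Real.log 2

/-- Conditional entropy `H(X|Z) = H(X,Z) - H(Z)`. -/
def condEntropy {Ω α γ : Type*} [Fintype Ω] [Fintype α] [Fintype γ]
    (μ : Ω → ℝ) (X : Ω → α) (Z : Ω → γ) : ℝ :=
  entropy μ (fun ω => (X ω, Z ω)) - entropy μ Z

/-- Conditional mutual information `I(X;Y|Z) = H(Y|Z) - H(Y|X,Z)`. -/
def condMutualInfo {Ω α β γ : Type*} [Fintype Ω] [Fintype α] [Fintype β] [Fintype γ]
    (μ : Ω → ℝ) (X : Ω → α) (Y : Ω → β) (Z : Ω → γ) : ℝ :=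
  condEntropy μ Y Z - condEntropy μ Y (fun ω => (X ω, Z ω))

/-- The maximal correlation of a pair with joint p.m.f. `p`: the supremum of `E[f(X) g(Y)]` over
zero-mean, unit-variance `f(X)`, `g(Y)`. (The supremum over the empty set is `0`, and the set is
bounded above by `1` when `p` is a p.m.f.) -/
def maxCorr {α β : Type*} [Fintype α] [Fintype β] (p : α × β → ℝ) : ℝ :=
  sSup {r : ℝ | ∃ (f : α → ℝ) (g : β → ℝ),
    ∑ z, p z * f z.1 = 0 ∧ ∑ z, p z * g z.2 = 0 ∧
    ∑ z, p z * f z.1 ^ 2 = 1 ∧ ∑ z, p z * g z.2 ^ 2 = 1 ∧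
    r = ∑ z, p z * (f z.1 * g z.2)}

section Sets

variable {S₁ S₂ : Type*} [Fintype S₁] [Fintype S₂]

/-- The `n`-letter Markov set `𝓑`, `n = m + 1`: conditional p.m.f.s `p(x₁,x₂|s₁,s₂)` which are
obtained from the i.i.d. pair of sequences `(S₁ⁿ,S₂ⁿ)` through the Markov chain
`X₁ - S₁ⁿ - S₂ⁿ - X₂`, with `(s₁,s₂)` the first letters of the sequences. The formula is imposed at
the pairs `(s₁,s₂)` of positive probability, where the conditional law is determined. -/
def markovSet (X₁ X₂ : Type*) [Fintype X₁] [Fintype X₂] (pS : S₁ × S₂ → ℝ) :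
    Set (S₁ × S₂ → X₁ × X₂ → ℝ) :=
  {κ | (∀ s, κ s ∈ stdSimplex ℝ (X₁ × X₂)) ∧
    ∃ (m : ℕ) (a : (Fin (m + 1) → S₁) → X₁ → ℝ) (b : (Fin (m + 1) → S₂) → X₂ → ℝ),
      (∀ t, a t ∈ stdSimplex ℝ X₁) ∧ (∀ t, b t ∈ stdSimplex ℝ X₂) ∧
      ∀ s₁ s₂ x₁ x₂, pS (s₁, s₂) ≠ 0 →
        κ (s₁, s₂) (x₁, x₂) = (pS (s₁, s₂))⁻¹ *
          ∑ t₁ : Fin m → S₁, ∑ t₂ : Fin m → S₂,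
            a (Fin.cons s₁ t₁) x₁ * b (Fin.cons s₂ t₂) x₂ *
              ∏ k : Fin (m + 1),
                pS ((Fin.cons s₁ t₁ : Fin (m + 1) → S₁) k,
                  (Fin.cons s₂ t₂ : Fin (m + 1) → S₂) k)}

/-- The maximal-correlation set `𝓑'`: conditional p.m.f.s `p(x₁,x₂|s₁,s₂)` for which the maximal
correlations of `(X₁,X₂)`, of `(X₁,X₂)` given `s₁`, given `s₂`, and given `(s₁,s₂)` (for values of
positive probability) do not exceed that of `(S₁,S₂)`. -/
def maxCorrSet (X₁ X₂ : Type*) [Fintype X₁] [Fintype X₂] (pS : S₁ × S₂ → ℝ) :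
    Set (S₁ × S₂ → X₁ × X₂ → ℝ) :=
  {κ | (∀ s, κ s ∈ stdSimplex ℝ (X₁ × X₂)) ∧
    maxCorr (fun x => ∑ s, pS s * κ s x) ≤ maxCorr pS ∧
    (∀ s₁, ∑ s₂, pS (s₁, s₂) ≠ 0 →
      maxCorr (fun x => (∑ s₂, pS (s₁, s₂))⁻¹ * ∑ s₂, pS (s₁, s₂) * κ (s₁, s₂) x)
        ≤ maxCorr pS) ∧
    (∀ s₂, ∑ s₁, pS (s₁, s₂) ≠ 0 →
      maxCorr (fun x => (∑ s₁, pS (s₁, s₂))⁻¹ * ∑ s₁, pS (s₁, s₂) * κ (s₁, s₂) x)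
        ≤ maxCorr pS) ∧
    (∀ s, pS s ≠ 0 → maxCorr (κ s) ≤ maxCorr pS)}

end Sets

/-- A source-channel code of blocklength `n`: two encoders, a causal relay (its `k`-th input is a
function of its past channel outputs and its whole side-information sequence), and a decoder. -/
structure Code (S₁ S₂ W W₃ X₁ X₂ X₃ Y Y₃ : Type*) (n : ℕ) where
  f₁ : (Fin n → S₁) → (Fin n → X₁)
  f₂ : (Fin n → S₂) → (Fin n → X₂)
  f₃ : (k : Fin n) → (Fin (k : ℕ) → Y₃) → (Fin n → W₃) → X₃
  g : (Fin n → Y) → (Fin n → W) → (Fin n → S₁) × (Fin n → S₂)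

variable {S₁ S₂ W W₃ X₁ X₂ X₃ Y Y₃ : Type*}
  [Fintype S₁] [Fintype S₂] [Fintype W] [Fintype W₃]
  [Fintype X₁] [Fintype X₂] [Fintype X₃] [Fintype Y] [Fintype Y₃]

/-- Joint probability of the source, side-information and output sequences when the code `c` is
used: i.i.d. sources with law `src`, memoryless channel `ch`. -/
def blockLaw (src : S₁ × S₂ × W × W₃ → ℝ) (ch : X₁ × X₂ × X₃ → Y × Y₃ → ℝ) {n : ℕ}
    (c : Code S₁ S₂ W W₃ X₁ X₂ X₃ Y Y₃ n)
    (s₁ : Fin n → S₁) (s₂ : Fin n → S₂) (w : Fin n → W) (w₃ : Fin n → W₃)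
    (y : Fin n → Y) (y₃ : Fin n → Y₃) : ℝ :=
  (∏ k, src (s₁ k, s₂ k, w k, w₃ k)) *
    ∏ k, ch (c.f₁ s₁ k, c.f₂ s₂ k, c.f₃ k (fun j => y₃ (Fin.castLE k.isLt.le j)) w₃) (y k, y₃ k)

/-- The average probability of error `Pr((Ŝ₁ⁿ,Ŝ₂ⁿ) ≠ (S₁ⁿ,S₂ⁿ))`. -/
def errorProb (src : S₁ × S₂ × W × W₃ → ℝ) (ch : X₁ × X₂ × X₃ → Y × Y₃ → ℝ) {n : ℕ}
    (c : Code S₁ S₂ W W₃ X₁ X₂ X₃ Y Y₃ n) : ℝ :=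
  open Classical in
  ∑ s₁ : Fin n → S₁, ∑ s₂ : Fin n → S₂, ∑ w : Fin n → W, ∑ w₃ : Fin n → W₃,
    ∑ y : Fin n → Y, ∑ y₃ : Fin n → Y₃,
      if c.g y w ≠ (s₁, s₂) then blockLaw src ch c s₁ s₂ w w₃ y y₃ else 0

/-- The sources can be reliably transmitted over the MARC with side information. -/
def ReliablyTransmissible (src : S₁ × S₂ × W × W₃ → ℝ) (ch : X₁ × X₂ × X₃ → Y × Y₃ → ℝ) : Prop :=
  ∃ c : (n : ℕ) → Code S₁ S₂ W W₃ X₁ X₂ X₃ Y Y₃ n,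
    Filter.Tendsto (fun n => errorProb src ch (c n)) Filter.atTop (𝓝 0)

/-- The marginal `p(s₁,s₂)`. -/
def sourcePair (src : S₁ × S₂ × W × W₃ → ℝ) : S₁ × S₂ → ℝ :=
  fun s => ∑ w, ∑ w₃, src (s.1, s.2, w, w₃)

/-- The joint p.m.f.
`p(q) p(s₁,s₂,w) p(x₁,x₂|s₁,s₂,q) p(x₃|x₁,x₂,s₁,s₂,q) p(y|x₁,x₂,x₃)`. -/
def jointLaw {Q : Type*} (src : S₁ × S₂ × W × W₃ → ℝ) (ch : X₁ × X₂ × X₃ → Y × Y₃ → ℝ)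
    (pQ : Q → ℝ) (κ : Q → S₁ × S₂ → X₁ × X₂ → ℝ) (r : X₁ × X₂ × S₁ × S₂ × Q → X₃ → ℝ) :
    Q × S₁ × S₂ × W × X₁ × X₂ × X₃ × Y → ℝ :=
  fun (q, s₁, s₂, w, x₁, x₂, x₃, y) =>
    pQ q * (∑ w₃, src (s₁, s₂, w, w₃)) * κ q (s₁, s₂) (x₁, x₂) *
      r (x₁, x₂, s₁, s₂, q) x₃ * ∑ y₃, ch (x₁, x₂, x₃) (y, y₃)

/-- The three constraints
`H(S₁|S₂,W) ≤ I(X₁,X₃;Y|S₂,X₂,W,Q) + ε`, `H(S₂|S₁,W) ≤ I(X₂,X₃;Y|S₁,X₁,W,Q) + ε`,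
`H(S₁,S₂|W) ≤ I(X₁,X₂,X₃;Y|W,Q) + ε`, the left-hand sides being evaluated under the source law
`src` and the right-hand sides under `μ`. -/
def MACConstraints {Q : Type*} [Fintype Q] (src : S₁ × S₂ × W × W₃ → ℝ)
    (μ : Q × S₁ × S₂ × W × X₁ × X₂ × X₃ × Y → ℝ) (ε : ℝ) : Prop :=
  condEntropy src (fun (s₁, _, _, _) => s₁) (fun (_, s₂, w, _) => (s₂, w)) ≤
    condMutualInfo μ (fun (_, _, _, _, x₁, _, x₃, _) => (x₁, x₃))
      (fun (_, _, _, _, _, _, _, y) => y)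
      (fun (q, _, s₂, w, _, x₂, _, _) => (s₂, x₂, w, q)) + ε ∧
  condEntropy src (fun (_, s₂, _, _) => s₂) (fun (s₁, _, w, _) => (s₁, w)) ≤
    condMutualInfo μ (fun (_, _, _, _, _, x₂, x₃, _) => (x₂, x₃))
      (fun (_, _, _, _, _, _, _, y) => y)
      (fun (q, s₁, _, w, x₁, _, _, _) => (s₁, x₁, w, q)) + ε ∧
  condEntropy src (fun (s₁, s₂, _, _) => (s₁, s₂)) (fun (_, _, w, _) => w) ≤
    condMutualInfo μ (fun (_, _, _, _, x₁, x₂, x₃, _) => (x₁, x₂, x₃))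
      (fun (_, _, _, _, _, _, _, y) => y)
      (fun (q, _, _, w, _, _, _, _) => (w, q)) + ε

end

end MARC

/-!
The theorem combines a tensorization argument for maximal correlation with a single-letter
converse.

*Maximal correlation.* For `0 ≤ c`, the bound `maxCorr p ≤ c` says that
`2 Cov(f,g) ≤ c (Var f + Var g)` for all `f(X)`, `g(Y)` (`CorrLE`, `corrLE_maxCorr`,
`maxCorr_le`). In this quadratic form the bound passes to
independent pairs by the laws of total covariance and total variance (`CorrLE.prod`), survives local
randomized processing because that can only decrease the variances (`CorrLE.kernel`), and is closed
in `p`. Given the first letters, the remaining source letters are still i.i.d., so all four laws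
in the definition of the maximal-correlation set come from independent pairs, each with maximal
correlation at most that of the source pair (`markovSet_subset_corrSet`).

*Removing the source letters.* An encoder may ignore the first letter of its block and work on fresh
ones. Hence the law of the inputs `(X₁,X₂)` of a code at a given time, read as a conditional law
that is constant in `(s₁,s₂)`, belongs to the Markov set (`const_mem_markovSet`). With such
conditional laws and `X₃` also conditionally independent of the sources, conditioning on sources and
side information has no effect on the outputs, and the right-hand sides become averages over `q` of
the mutual informations `I(X₁,X₂,X₃;Y|V)` with `V` equal to `X₂`, `X₁` or a constant
(`macConstraints_jointLaw`). Removing the conditioning can only increase these bounds, so nothing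
is lost; in particular the dependence of the relay input on `W` through `W₃` plays no role.

*Converse.* The bounds for a code are obtained in one step, without chain rules. Write `T` for the
letters to be decoded given `Z`, let `a`, `d`, `w` be the products over time of the conditional
probabilities of `T` given `Z`, of the output given `V`, and of the output given the channel inputs,
and let `f` be the sub-probability of Fano's inequality. Then `E[f d / (a w)] ≤ 1`: causality lets
the relay outputs be summed out one after the other, and the remaining sums are over conditional
probabilities (`sum_seqLaw_mul_ratio_le`). Since `log t ≤ t - 1`, the expected logarithm is
nonpositive, and this is the bound `oneShot_converse` of `n H(T|Z)` by a Fano term and the sum over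
time of the single-letter mutual informations. Averaging over time, Carathéodory's theorem in `ℝ³`
leaves four values of the time-sharing variable, and compactness removes the slack `ε` at the price
of the closure (`exists_jointLaw_closure`).
-/

namespace MARC

noncomputable section

/-! ### Maximal correlation as a covariance inequality -/

section Corr

variable {α β γ δ : Type*} [Fintype α] [Fintype β] [Fintype γ] [Fintype δ]

/-- The covariance inequality `2 Cov(f,g) ≤ c (Var f + Var g)` for all real `f(X)`, `g(Y)`, where
`(X,Y)` has p.m.f. `p`. For `0 ≤ c` it is equivalent, by rescaling `f` and `g`, to the maximal
correlation being at most `c`; unlike the latter it is visibly additive over independent pairs and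
closed in `p`. -/
def CorrLE (p : α × β → ℝ) (c : ℝ) : Prop :=
  ∀ (f : α → ℝ) (g : β → ℝ),
    2 * (∑ z, p z * (f z.1 * g z.2) - (∑ z, p z * f z.1) * ∑ z, p z * g z.2) ≤
      c * ((∑ z, p z * f z.1 ^ 2 - (∑ z, p z * f z.1) ^ 2) +
        (∑ z, p z * g z.2 ^ 2 - (∑ z, p z * g z.2) ^ 2))

lemma sum_mul_sq_ge_sq_sum {p : α → ℝ} (hp : p ∈ stdSimplex ℝ α) (f : α → ℝ) :
    (∑ a, p a * f a) ^ 2 ≤ ∑ a, p a * f a ^ 2 := by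
  have h : 0 ≤ ∑ a, p a * (f a - ∑ b, p b * f b) ^ 2 :=
    Finset.sum_nonneg fun a _ => mul_nonneg (hp.1 a) (sq_nonneg _)
  set m := ∑ b, p b * f b with hm
  have e : ∑ a, p a * (f a - m) ^ 2 = ∑ a, p a * f a ^ 2 - 2 * m * m + m ^ 2 * ∑ a, p a := by
    have : ∀ a, p a * (f a - m) ^ 2 = p a * f a ^ 2 - 2 * m * (p a * f a) + m ^ 2 * p a :=
      fun a => by ring
    simp only [this, Finset.sum_add_distrib, Finset.sum_sub_distrib, ← Finset.mul_sum, ← hm]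
  rw [e, hp.2] at h
  linarith

lemma maxCorr_le {p : α × β → ℝ} {c : ℝ} (hc : 0 ≤ c) (h : CorrLE p c) : maxCorr p ≤ c := by
  refine Real.sSup_le ?_ hc
  rintro r ⟨f, g, hf, hg, hf2, hg2, rfl⟩
  have := h f g
  rw [hf, hg, hf2, hg2] at this
  linarith

lemma bddAbove_corr {p : α × β → ℝ} (hp : ∀ z, 0 ≤ p z) :
    BddAbove {r : ℝ | ∃ (f : α → ℝ) (g : β → ℝ),
      ∑ z, p z * f z.1 = 0 ∧ ∑ z, p z * g z.2 = 0 ∧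
      ∑ z, p z * f z.1 ^ 2 = 1 ∧ ∑ z, p z * g z.2 ^ 2 = 1 ∧
      r = ∑ z, p z * (f z.1 * g z.2)} := by
  refine ⟨1, ?_⟩
  rintro r ⟨f, g, -, -, hf2, hg2, rfl⟩
  have : ∑ z, p z * (f z.1 * g z.2) ≤
      ∑ z, (p z * f z.1 ^ 2 + p z * g z.2 ^ 2) / 2 := by
    refine Finset.sum_le_sum fun z _ => ?_
    nlinarith [mul_nonneg (hp z) (sq_nonneg (f z.1 - g z.2))]
  rw [← Finset.sum_div, Finset.sum_add_distrib, hf2, hg2] at this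
  linarith

lemma maxCorr_nonneg {p : α × β → ℝ} (hp : ∀ z, 0 ≤ p z) : 0 ≤ maxCorr p := by
  unfold maxCorr
  by_cases hne : {r : ℝ | ∃ (f : α → ℝ) (g : β → ℝ),
      ∑ z, p z * f z.1 = 0 ∧ ∑ z, p z * g z.2 = 0 ∧
      ∑ z, p z * f z.1 ^ 2 = 1 ∧ ∑ z, p z * g z.2 ^ 2 = 1 ∧
      r = ∑ z, p z * (f z.1 * g z.2)}.Nonempty
  · obtain ⟨r, f, g, hf, hg, hf2, hg2, hr⟩ := hne
    have h1 := le_csSup (bddAbove_corr hp) ⟨f, g, hf, hg, hf2, hg2, hr⟩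
    have h2 := le_csSup (bddAbove_corr hp) (a := -r)
      ⟨fun a => -f a, g, by simp [hf], hg, by simpa using hf2, hg2, by simp [hr]⟩
    linarith
  · rw [Set.not_nonempty_iff_eq_empty.1 hne, Real.sSup_empty]

/-- The maximal correlation is itself an admissible constant in the covariance inequality. -/
lemma corrLE_maxCorr {p : α × β → ℝ} (hp : p ∈ stdSimplex ℝ (α × β)) : CorrLE p (maxCorr p) := by
  intro f g
  set mf := ∑ z, p z * f z.1 with hmf
  set mg := ∑ z, p z * g z.2 with hmg
  set F : α → ℝ := fun a => f a - mf
  set G : β → ℝ := fun b => g b - mg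
  have hF : ∑ z, p z * F z.1 = 0 := by
    simp only [F, mul_sub, Finset.sum_sub_distrib, ← Finset.sum_mul, hp.2, ← hmf]; ring
  have hG : ∑ z, p z * G z.2 = 0 := by
    simp only [G, mul_sub, Finset.sum_sub_distrib, ← Finset.sum_mul, hp.2, ← hmg]; ring
  have hF2 : ∑ z, p z * F z.1 ^ 2 = ∑ z, p z * f z.1 ^ 2 - mf ^ 2 := by
    have : ∀ z, p z * F z.1 ^ 2 = p z * f z.1 ^ 2 - 2 * mf * (p z * F z.1) - p z * mf ^ 2 :=
      fun z => by simp only [F]; ring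
    simp only [this, Finset.sum_sub_distrib, ← Finset.mul_sum, hF, ← Finset.sum_mul, hp.2]; ring
  have hG2 : ∑ z, p z * G z.2 ^ 2 = ∑ z, p z * g z.2 ^ 2 - mg ^ 2 := by
    have : ∀ z, p z * G z.2 ^ 2 = p z * g z.2 ^ 2 - 2 * mg * (p z * G z.2) - p z * mg ^ 2 :=
      fun z => by simp only [G]; ring
    simp only [this, Finset.sum_sub_distrib, ← Finset.mul_sum, hG, ← Finset.sum_mul, hp.2]; ring
  have hFG : ∑ z, p z * (F z.1 * G z.2) = ∑ z, p z * (f z.1 * g z.2) - mf * mg := by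
    have : ∀ z, p z * (F z.1 * G z.2) =
        p z * (f z.1 * g z.2) - mg * (p z * F z.1) - mf * (p z * G z.2) - p z * (mf * mg) :=
      fun z => by simp only [F, G]; ring
    simp only [this, Finset.sum_sub_distrib, ← Finset.mul_sum, hF, hG, ← Finset.sum_mul, hp.2]
    ring
  rw [← hF2, ← hG2, ← hFG]
  set vf := ∑ z, p z * F z.1 ^ 2 with hvf
  set vg := ∑ z, p z * G z.2 ^ 2 with hvg
  have hvf0 : 0 ≤ vf := Finset.sum_nonneg fun z _ => mul_nonneg (hp.1 z) (sq_nonneg _)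
  have hvg0 : 0 ≤ vg := Finset.sum_nonneg fun z _ => mul_nonneg (hp.1 z) (sq_nonneg _)
  have hnn := maxCorr_nonneg hp.1
  -- If one of the variances vanishes, then so does the covariance.
  by_cases h0 : vf = 0 ∨ vg = 0
  · have : ∑ z, p z * (F z.1 * G z.2) = 0 := by
      refine Finset.sum_eq_zero fun z _ => ?_
      rcases h0 with h0 | h0
      · have := (Finset.sum_eq_zero_iff_of_nonneg
          (fun z _ => mul_nonneg (hp.1 z) (sq_nonneg _))).1 h0 z (Finset.mem_univ _)
        rcases mul_eq_zero.1 this with h | h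
        · simp [h]
        · simp [pow_eq_zero_iff two_ne_zero |>.1 h]
      · have := (Finset.sum_eq_zero_iff_of_nonneg
          (fun z _ => mul_nonneg (hp.1 z) (sq_nonneg _))).1 h0 z (Finset.mem_univ _)
        rcases mul_eq_zero.1 this with h | h
        · simp [h]
        · simp [pow_eq_zero_iff two_ne_zero |>.1 h]
    rw [this]
    have := mul_nonneg hnn (add_nonneg hvf0 hvg0)
    linarith
  · push Not at h0
    have pf : 0 < vf := lt_of_le_of_ne hvf0 (Ne.symm h0.1)
    have pg : 0 < vg := lt_of_le_of_ne hvg0 (Ne.symm h0.2)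
    set a := Real.sqrt vf with ha
    set b := Real.sqrt vg with hb
    have pa : 0 < a := Real.sqrt_pos.2 pf
    have pb : 0 < b := Real.sqrt_pos.2 pg
    have haa : a ^ 2 = vf := Real.sq_sqrt hvf0
    have hbb : b ^ 2 = vg := Real.sq_sqrt hvg0
    have key : a⁻¹ * b⁻¹ * ∑ z, p z * (F z.1 * G z.2) ≤ maxCorr p := by
      refine le_csSup (bddAbove_corr hp.1)
        ⟨fun x => a⁻¹ * F x, fun y => b⁻¹ * G y, ?_, ?_, ?_, ?_, ?_⟩
      · have : ∀ z : α × β, p z * (a⁻¹ * F z.1) = a⁻¹ * (p z * F z.1) := fun z => by ring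
        simp only [this, ← Finset.mul_sum, hF, mul_zero]
      · have : ∀ z : α × β, p z * (b⁻¹ * G z.2) = b⁻¹ * (p z * G z.2) := fun z => by ring
        simp only [this, ← Finset.mul_sum, hG, mul_zero]
      · have : ∀ z : α × β, p z * (a⁻¹ * F z.1) ^ 2 = (a ^ 2)⁻¹ * (p z * F z.1 ^ 2) :=
          fun z => by ring
        simp only [this, ← Finset.mul_sum, haa, ← hvf]
        exact inv_mul_cancel₀ h0.1
      · have : ∀ z : α × β, p z * (b⁻¹ * G z.2) ^ 2 = (b ^ 2)⁻¹ * (p z * G z.2 ^ 2) :=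
          fun z => by ring
        simp only [this, ← Finset.mul_sum, hbb, ← hvg]
        exact inv_mul_cancel₀ h0.2
      · rw [Finset.mul_sum]
        exact Finset.sum_congr rfl fun z _ => by ring
    rw [← mul_inv, inv_mul_le_iff₀ (mul_pos pa pb)] at key
    have : maxCorr p * (2 * (a * b)) ≤ maxCorr p * (a ^ 2 + b ^ 2) :=
      mul_le_mul_of_nonneg_left (by nlinarith [sq_nonneg (a - b)]) hnn
    rw [← haa, ← hbb]
    linarith

lemma sum_mul_prodProdProdComm (p : α × β → ℝ) (q : γ × δ → ℝ) (φ : (α × γ) × (β × δ) → ℝ) :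
    ∑ z : (α × γ) × (β × δ), p (z.1.1, z.2.1) * q (z.1.2, z.2.2) * φ z =
      ∑ z : α × β, p z * ∑ w : γ × δ, q w * φ ((z.1, w.1), (z.2, w.2)) := by
  rw [← (Equiv.prodProdProdComm α β γ δ).sum_comp, Fintype.sum_prod_type]
  simp only [Equiv.prodProdProdComm_apply, Finset.mul_sum, mul_assoc]

/-- Tensorization: by the law of total covariance, applied conditionally on the first pair, the
covariance inequality passes to a pair of independent pairs. -/
lemma CorrLE.prod {p : α × β → ℝ} {q : γ × δ → ℝ} {c : ℝ} (hp0 : ∀ z, 0 ≤ p z)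
    (hp : CorrLE p c) (hq : CorrLE q c) :
    CorrLE (fun z : (α × γ) × (β × δ) => p (z.1.1, z.2.1) * q (z.1.2, z.2.2)) c := by
  intro f g
  simp only [sum_mul_prodProdProdComm]
  set F : α → ℝ := fun a => ∑ w : γ × δ, q w * f (a, w.1)
  set G : β → ℝ := fun b => ∑ w : γ × δ, q w * g (b, w.2)
  have h1 := hp F G
  have h2 : ∑ z : α × β, p z * (2 * (∑ w : γ × δ, q w * (f (z.1, w.1) * g (z.2, w.2)) -
      F z.1 * G z.2)) ≤ ∑ z : α × β, p z * (c * ((∑ w : γ × δ, q w * f (z.1, w.1) ^ 2 -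
        F z.1 ^ 2) + (∑ w : γ × δ, q w * g (z.2, w.2) ^ 2 - G z.2 ^ 2))) :=
    Finset.sum_le_sum fun z _ => mul_le_mul_of_nonneg_left
      (hq (fun x => f (z.1, x)) fun y => g (z.2, y)) (hp0 z)
  have e1 : ∀ A B : α × β → ℝ, ∑ z, p z * (2 * (A z - B z)) =
      2 * (∑ z, p z * A z - ∑ z, p z * B z) := fun A B => by
    rw [← Finset.sum_sub_distrib, Finset.mul_sum]
    exact Finset.sum_congr rfl fun z _ => by ring
  have e2 : ∀ A B C D : α × β → ℝ, ∑ z, p z * (c * ((A z - B z) + (C z - D z))) =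
      c * ((∑ z, p z * A z - ∑ z, p z * B z) + (∑ z, p z * C z - ∑ z, p z * D z)) :=
    fun A B C D => by
      rw [← Finset.sum_sub_distrib, ← Finset.sum_sub_distrib, ← Finset.sum_add_distrib,
        Finset.mul_sum]
      exact Finset.sum_congr rfl fun z _ => by ring
  rw [e1 (fun z => ∑ w : γ × δ, q w * (f (z.1, w.1) * g (z.2, w.2))) (fun z => F z.1 * G z.2),
    e2 (fun z => ∑ w : γ × δ, q w * f (z.1, w.1) ^ 2) (fun z => F z.1 ^ 2)
      (fun z => ∑ w : γ × δ, q w * g (z.2, w.2) ^ 2) (fun z => G z.2 ^ 2)] at h2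
  linarith

/-- Data processing: local randomized processing of the two components does not increase the
correlation. -/
lemma CorrLE.kernel {p : α × β → ℝ} {c : ℝ} (hc : 0 ≤ c) (hp0 : ∀ z, 0 ≤ p z) (hp : CorrLE p c)
    {K : α → γ → ℝ} {L : β → δ → ℝ} (hK : ∀ a, K a ∈ stdSimplex ℝ γ)
    (hL : ∀ b, L b ∈ stdSimplex ℝ δ) :
    CorrLE (fun x : γ × δ => ∑ z, p z * (K z.1 x.1 * L z.2 x.2)) c := by
  have S : ∀ φ : γ → ℝ, ∀ ψ : δ → ℝ,
      ∑ x : γ × δ, (∑ z, p z * (K z.1 x.1 * L z.2 x.2)) * (φ x.1 * ψ x.2) =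
        ∑ z, p z * ((∑ x, K z.1 x * φ x) * ∑ y, L z.2 y * ψ y) := by
    intro φ ψ
    simp only [Finset.sum_mul]
    rw [Finset.sum_comm]
    refine Finset.sum_congr rfl fun z _ => ?_
    rw [Fintype.sum_prod_type, Finset.mul_sum]
    refine Finset.sum_congr rfl fun x _ => ?_
    rw [Finset.mul_sum, Finset.mul_sum]
    exact Finset.sum_congr rfl fun y _ => by ring
  have S1 : ∀ φ : γ → ℝ, ∑ x : γ × δ, (∑ z, p z * (K z.1 x.1 * L z.2 x.2)) * φ x.1 =
        ∑ z, p z * ∑ x, K z.1 x * φ x := by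
    intro φ
    have := S φ 1
    simpa [(hL _).2] using this
  have S2 : ∀ ψ : δ → ℝ, ∑ x : γ × δ, (∑ z, p z * (K z.1 x.1 * L z.2 x.2)) * ψ x.2 =
        ∑ z, p z * ∑ y, L z.2 y * ψ y := by
    intro ψ
    have := S 1 ψ
    simpa [(hK _).2] using this
  intro f g
  rw [S f g, S1 f, S2 g, S1 (fun x => f x ^ 2), S2 (fun y => g y ^ 2)]
  refine (hp (fun a => ∑ x, K a x * f x) fun b => ∑ y, L b y * g y).trans ?_
  refine mul_le_mul_of_nonneg_left ?_ hc
  refine add_le_add (sub_le_sub_right ?_ _) (sub_le_sub_right ?_ _)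
  · exact Finset.sum_le_sum fun z _ => mul_le_mul_of_nonneg_left
      (sum_mul_sq_ge_sq_sum (hK z.1) f) (hp0 z)
  · exact Finset.sum_le_sum fun z _ => mul_le_mul_of_nonneg_left
      (sum_mul_sq_ge_sq_sum (hL z.2) g) (hp0 z)

/-- Local processing of two independent pairs. -/
lemma CorrLE.prod_kernel {ξ η : Type*} [Fintype ξ] [Fintype η] {p : α × β → ℝ} {q : γ × δ → ℝ}
    {c : ℝ} (hc : 0 ≤ c) (hp0 : ∀ z, 0 ≤ p z) (hq0 : ∀ z, 0 ≤ q z) (hp : CorrLE p c)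
    (hq : CorrLE q c) {K : α → γ → ξ → ℝ} {L : β → δ → η → ℝ}
    (hK : ∀ a t, K a t ∈ stdSimplex ℝ ξ) (hL : ∀ b t, L b t ∈ stdSimplex ℝ η) :
    CorrLE (fun x : ξ × η => ∑ z, p z * ∑ t, q t * (K z.1 t.1 x.1 * L z.2 t.2 x.2)) c := by
  have := (CorrLE.prod hp0 hp hq).kernel hc (fun z => mul_nonneg (hp0 _) (hq0 _))
    (K := fun z : α × γ => K z.1 z.2) (L := fun z : β × δ => L z.1 z.2)
    (fun _ => hK _ _) (fun _ => hL _ _)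
  simpa only [sum_mul_prodProdProdComm p q] using this

lemma CorrLE.of_equiv (e₁ : α ≃ γ) (e₂ : β ≃ δ) {p : γ × δ → ℝ} {c : ℝ}
    (h : CorrLE (fun z : α × β => p (e₁ z.1, e₂ z.2)) c) : CorrLE p c := by
  intro f g
  have := h (f ∘ e₁) (g ∘ e₂)
  have S : ∀ φ : γ × δ → ℝ, ∑ z : α × β, φ (e₁ z.1, e₂ z.2) = ∑ z, φ z :=
    fun φ => (Equiv.prodCongr e₁ e₂).sum_comp φ
  simpa only [Function.comp, S (fun z => p z * (f z.1 * g z.2)), S (fun z => p z * f z.1),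
    S (fun z => p z * g z.2), S (fun z => p z * f z.1 ^ 2), S (fun z => p z * g z.2 ^ 2)] using this

/-- A constant is uncorrelated with everything. -/
lemma corrLE_unit_left {p : Unit × β → ℝ} (hp : p ∈ stdSimplex ℝ (Unit × β)) {c : ℝ}
    (hc : 0 ≤ c) : CorrLE p c := by
  intro f g
  have h := mul_nonneg hc (sub_nonneg.2 (sum_mul_sq_ge_sq_sum hp fun z => g z.2))
  have e : ∀ z : Unit × β, f z.1 = f () := fun _ => rfl
  have e1 : ∀ z : Unit × β, p z * (f () * g z.2) = f () * (p z * g z.2) := fun _ => by ring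
  simp only [e, e1, ← Finset.mul_sum, ← Finset.sum_mul, hp.2]
  linarith

lemma corrLE_unit_right {p : α × Unit → ℝ} (hp : p ∈ stdSimplex ℝ (α × Unit)) {c : ℝ}
    (hc : 0 ≤ c) : CorrLE p c := by
  intro f g
  have h := mul_nonneg hc (sub_nonneg.2 (sum_mul_sq_ge_sq_sum hp fun z => f z.1))
  have e : ∀ z : α × Unit, g z.2 = g () := fun _ => rfl
  have e1 : ∀ z : α × Unit, p z * (f z.1 * g ()) = g () * (p z * f z.1) := fun _ => by ring
  simp only [e, e1, ← Finset.mul_sum, ← Finset.sum_mul, hp.2]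
  linarith

/-- Tensorization for i.i.d. sequences of pairs. -/
lemma CorrLE.iid {p : α × β → ℝ} {c : ℝ} (hp0 : ∀ z, 0 ≤ p z) (hp : CorrLE p c) (m : ℕ) :
    CorrLE (fun t : (Fin m → α) × (Fin m → β) => ∏ k, p (t.1 k, t.2 k)) c := by
  induction m with
  | zero => intro f g; simp [Fintype.sum_prod_type]
  | succ m ih =>
    refine CorrLE.of_equiv (Fin.consEquiv fun _ => α) (Fin.consEquiv fun _ => β) ?_
    have := CorrLE.prod hp0 hp ih
    simpa [Fin.prod_univ_succ, Fin.consEquiv] using this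

lemma isClosed_corrLE {ι : Type*} [TopologicalSpace ι] {p : ι → α × β → ℝ} (hp : Continuous p)
    (c : ℝ) : IsClosed {i | CorrLE (p i) c} := by
  have hp' : ∀ z, Continuous fun i => p i z := fun z => (continuous_apply z).comp hp
  simp only [CorrLE, Set.ofPred_forall]
  exact isClosed_iInter fun f => isClosed_iInter fun g =>
    isClosed_le (by fun_prop) (by fun_prop)

end Corr

/-! ### The Markov set and the maximal-correlation set -/

section MarkovSet

variable {S₁ S₂ X₁ X₂ : Type*} [Fintype S₁] [Fintype S₂] [Fintype X₁] [Fintype X₂]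

lemma prod_mem_stdSimplex {α β : Type*} [Fintype α] [Fintype β] {p : α × β → ℝ}
    (hp : p ∈ stdSimplex ℝ (α × β)) (m : ℕ) :
    (fun t : (Fin m → α) × (Fin m → β) => ∏ k, p (t.1 k, t.2 k)) ∈
      stdSimplex ℝ ((Fin m → α) × (Fin m → β)) := by
  refine ⟨fun t => Finset.prod_nonneg fun k _ => hp.1 _, ?_⟩
  rw [← (Equiv.arrowProdEquivProdArrow (Fin m) (fun _ => α) (fun _ => β)).sum_comp]
  simp only [Equiv.arrowProdEquivProdArrow, Equiv.coe_fn_mk, Prod.mk.eta]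
  classical
  rw [← Fintype.piFinset_univ, ← Finset.prod_univ_sum]
  simp [hp.2]

/-- The maximal-correlation set with the bounds on maximal correlations replaced by covariance
inequalities with constant `c`. It is closed, and for `c = maxCorr pS` it is contained in the
maximal-correlation set. -/
def corrSet (X₁ X₂ : Type*) [Fintype X₁] [Fintype X₂] (pS : S₁ × S₂ → ℝ) (c : ℝ) :
    Set (S₁ × S₂ → X₁ × X₂ → ℝ) :=
  {κ | (∀ s, κ s ∈ stdSimplex ℝ (X₁ × X₂)) ∧
    CorrLE (fun x => ∑ s, pS s * κ s x) c ∧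
    (∀ s₁, ∑ s₂, pS (s₁, s₂) ≠ 0 →
      CorrLE (fun x => (∑ s₂, pS (s₁, s₂))⁻¹ * ∑ s₂, pS (s₁, s₂) * κ (s₁, s₂) x) c) ∧
    (∀ s₂, ∑ s₁, pS (s₁, s₂) ≠ 0 →
      CorrLE (fun x => (∑ s₁, pS (s₁, s₂))⁻¹ * ∑ s₁, pS (s₁, s₂) * κ (s₁, s₂) x) c) ∧
    (∀ s, pS s ≠ 0 → CorrLE (κ s) c)}

lemma isClosed_corrSet (pS : S₁ × S₂ → ℝ) (c : ℝ) : IsClosed (corrSet X₁ X₂ pS c) := by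
  simp only [corrSet, Set.ofPred_and, Set.ofPred_forall]
  refine .inter (isClosed_iInter fun s => ?_) (.inter ?_ (.inter ?_ (.inter ?_ ?_)))
  · exact (isClosed_stdSimplex ℝ (X₁ × X₂)).preimage (continuous_apply s)
  · exact isClosed_corrLE (by fun_prop) c
  · exact isClosed_iInter fun s => isClosed_iInter fun _ => isClosed_corrLE (by fun_prop) c
  · exact isClosed_iInter fun s => isClosed_iInter fun _ => isClosed_corrLE (by fun_prop) c
  · exact isClosed_iInter fun s => isClosed_iInter fun _ => isClosed_corrLE (by fun_prop) c

lemma corrSet_subset_maxCorrSet {pS : S₁ × S₂ → ℝ} (hpS : ∀ s, 0 ≤ pS s) :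
    corrSet X₁ X₂ pS (maxCorr pS) ⊆ maxCorrSet X₁ X₂ pS := by
  have h0 := maxCorr_nonneg hpS
  rintro κ ⟨h, h1, h2, h3, h4⟩
  exact ⟨h, maxCorr_le h0 h1, fun s hs => maxCorr_le h0 (h2 s hs),
    fun s hs => maxCorr_le h0 (h3 s hs), fun s hs => maxCorr_le h0 (h4 s hs)⟩

/-- Conditionally on the first letters, the remaining letters of the source sequences are
i.i.d., so all four laws of `(X₁,X₂)` arise by local processing of a product of i.i.d. pairs with
one further independent pair: again a source pair, or a constant with a letter. -/
lemma markovSet_subset_corrSet {pS : S₁ × S₂ → ℝ} (hpS : pS ∈ stdSimplex ℝ (S₁ × S₂)) :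
    markovSet X₁ X₂ pS ⊆ corrSet X₁ X₂ pS (maxCorr pS) := by
  rintro κ ⟨hκ, m, a, b, ha, hb, hab⟩
  set c := maxCorr pS
  have hc : 0 ≤ c := maxCorr_nonneg hpS.1
  have hp := corrLE_maxCorr hpS
  set T : (Fin m → S₁) × (Fin m → S₂) → ℝ := fun t => ∏ k, pS (t.1 k, t.2 k) with hT
  have hT0 : ∀ t, 0 ≤ T t := (prod_mem_stdSimplex hpS m).1
  have hTc : CorrLE T c := hp.iid hpS.1 m
  have hκT : ∀ s₁ s₂, pS (s₁, s₂) ≠ 0 → ∀ x, κ (s₁, s₂) x =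
      ∑ t, T t * (a (Fin.cons s₁ t.1) x.1 * b (Fin.cons s₂ t.2) x.2) := by
    intro s₁ s₂ hs x
    rw [show x = (x.1, x.2) from rfl, hab s₁ s₂ x.1 x.2 hs, inv_mul_eq_iff_eq_mul₀ hs,
      Fintype.sum_prod_type, Finset.mul_sum]
    refine Finset.sum_congr rfl fun t₁ _ => ?_
    rw [Finset.mul_sum]
    refine Finset.sum_congr rfl fun t₂ _ => ?_
    simp only [hT, Fin.prod_univ_succ, Fin.cons_zero, Fin.cons_succ]
    ring
  have hκT' : ∀ s₁ s₂ x, pS (s₁, s₂) * κ (s₁, s₂) x =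
      pS (s₁, s₂) * ∑ t, T t * (a (Fin.cons s₁ t.1) x.1 * b (Fin.cons s₂ t.2) x.2) := by
    intro s₁ s₂ x
    by_cases hs : pS (s₁, s₂) = 0
    · simp [hs]
    · rw [hκT s₁ s₂ hs]
  refine ⟨hκ, ?_, ?_, ?_, ?_⟩
  · have := CorrLE.prod_kernel hc hpS.1 hT0 hp hTc (K := fun s t x => a (Fin.cons s t) x)
      (L := fun s t x => b (Fin.cons s t) x) (fun _ _ => ha _) (fun _ _ => hb _)
    simpa only [← hκT'] using this
  · intro s₁ hs
    set P := ∑ s₂, pS (s₁, s₂) with hP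
    have hP0 : 0 ≤ P := Finset.sum_nonneg fun _ _ => hpS.1 _
    have hu : (fun z : Unit × S₂ => P⁻¹ * pS (s₁, z.2)) ∈ stdSimplex ℝ (Unit × S₂) := by
      refine ⟨fun z => mul_nonneg (inv_nonneg.2 hP0) (hpS.1 _), ?_⟩
      simp [Fintype.sum_prod_type, ← Finset.mul_sum, ← hP, inv_mul_cancel₀ hs]
    have := CorrLE.prod_kernel hc hu.1 hT0 (corrLE_unit_left hu hc) hTc
      (K := fun _ t x => a (Fin.cons s₁ t) x)
      (L := fun s t x => b (Fin.cons s t) x) (fun _ _ => ha _) (fun _ _ => hb _)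
    simpa only [Fintype.sum_prod_type (α₁ := Unit), Fintype.sum_unique, mul_assoc, ← hκT',
      ← Finset.mul_sum] using this
  · intro s₂ hs
    set P := ∑ s₁, pS (s₁, s₂) with hP
    have hP0 : 0 ≤ P := Finset.sum_nonneg fun _ _ => hpS.1 _
    have hu : (fun z : S₁ × Unit => P⁻¹ * pS (z.1, s₂)) ∈ stdSimplex ℝ (S₁ × Unit) := by
      refine ⟨fun z => mul_nonneg (inv_nonneg.2 hP0) (hpS.1 _), ?_⟩
      simp [Fintype.sum_prod_type, ← Finset.mul_sum, ← hP, inv_mul_cancel₀ hs]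
    have := CorrLE.prod_kernel hc hu.1 hT0 (corrLE_unit_right hu hc) hTc
      (K := fun s t x => a (Fin.cons s t) x)
      (L := fun _ t x => b (Fin.cons s₂ t) x) (fun _ _ => ha _) (fun _ _ => hb _)
    simpa only [Fintype.sum_prod_type_right (α₂ := Unit), Fintype.sum_unique, mul_assoc, ← hκT',
      ← Finset.mul_sum] using this
  · rintro ⟨s₁, s₂⟩ hs
    have := hTc.kernel hc hT0
      (K := fun z : Fin m → S₁ => a (Fin.cons s₁ z))
      (L := fun z : Fin m → S₂ => b (Fin.cons s₂ z)) (fun _ => ha _) (fun _ => hb _)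
    simpa only [← hκT s₁ s₂ hs] using this

lemma closure_markovSet_subset_corrSet {pS : S₁ × S₂ → ℝ} (hpS : pS ∈ stdSimplex ℝ (S₁ × S₂)) :
    closure (markovSet X₁ X₂ pS) ⊆ corrSet X₁ X₂ pS (maxCorr pS) :=
  closure_minimal (markovSet_subset_corrSet hpS) (isClosed_corrSet _ _)

end MarkovSet

/-! ### Causal products -/

section Causal

variable {B : Type*} {n : ℕ}

/-- The past `z₀, …, z_{k-1}` of a sequence at time `k`. -/
def past (z : Fin n → B) (k : Fin n) : Fin (k : ℕ) → B := fun j => z (Fin.castLE k.isLt.le j)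

/-- The product of conditional probabilities `∏ₖ c(zₖ | z₀, …, z_{k-1})`. -/
def causalProd (c : (k : Fin n) → (Fin (k : ℕ) → B) → B → ℝ) (z : Fin n → B) : ℝ :=
  ∏ k, c k (past z k) (z k)

lemma sum_eq_sum_snoc [Fintype B] (φ : (Fin (n + 1) → B) → ℝ) :
    ∑ z, φ z = ∑ h : Fin n → B, ∑ b, φ (Fin.snoc h b) := by
  rw [← (Fin.snocEquiv fun _ => B).sum_comp, Fintype.sum_prod_type, Finset.sum_comm]
  rfl

lemma past_snoc_castSucc (h : Fin n → B) (b : B) (k : Fin n) :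
    past (Fin.snoc h b : Fin (n + 1) → B) k.castSucc = past h k := by
  funext j
  exact Fin.snoc_castSucc (α := fun _ => B) b h (Fin.castLE k.isLt.le j)

lemma past_snoc_last (h : Fin n → B) (b : B) :
    past (Fin.snoc h b : Fin (n + 1) → B) (Fin.last n) = h := by
  funext j
  exact Fin.snoc_castSucc (α := fun _ => B) b h j

lemma causalProd_snoc (c : (k : Fin (n + 1)) → (Fin (k : ℕ) → B) → B → ℝ) (h : Fin n → B) (b : B) :
    causalProd c (Fin.snoc h b) =
      causalProd (fun k : Fin n => c k.castSucc) h * c (Fin.last n) h b := by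
  unfold causalProd
  rw [Fin.prod_univ_castSucc, past_snoc_last, Fin.snoc_last]
  congr 1
  refine Finset.prod_congr rfl fun k _ => ?_
  rw [past_snoc_castSucc, Fin.snoc_castSucc]

lemma causalProd_nonneg {c : (k : Fin n) → (Fin (k : ℕ) → B) → B → ℝ}
    (hc : ∀ k h b, 0 ≤ c k h b) (z : Fin n → B) : 0 ≤ causalProd c z :=
  Finset.prod_nonneg fun _ _ => hc _ _ _

variable [Fintype B]

lemma sum_causalProd {c : (k : Fin n) → (Fin (k : ℕ) → B) → B → ℝ}
    (hc : ∀ k h, ∑ b, c k h b = 1) : ∑ z, causalProd c z = 1 := by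
  induction n with
  | zero => simp [causalProd]
  | succ n ih =>
    rw [sum_eq_sum_snoc]
    simp only [causalProd_snoc, ← Finset.mul_sum, hc, mul_one]
    exact ih fun k h => hc k.castSucc h

lemma sum_causalProd_le {c : (k : Fin n) → (Fin (k : ℕ) → B) → B → ℝ}
    (h0 : ∀ k h b, 0 ≤ c k h b) (hc : ∀ k h, ∑ b, c k h b ≤ 1) : ∑ z, causalProd c z ≤ 1 := by
  induction n with
  | zero => simp [causalProd]
  | succ n ih =>
    rw [sum_eq_sum_snoc]
    simp only [causalProd_snoc, ← Finset.mul_sum]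
    refine (Finset.sum_le_sum fun h _ => ?_).trans
      (ih (fun k h => h0 k.castSucc h) fun k h => hc k.castSucc h)
    exact mul_le_of_le_one_right (causalProd_nonneg (fun k h => h0 k.castSucc h) h) (hc _ _)

/-- Averaging out the letter at time `k` given its past: the later letters sum to one. -/
lemma sum_causalProd_mul {c : (k : Fin n) → (Fin (k : ℕ) → B) → B → ℝ}
    (hc : ∀ k h, ∑ b, c k h b = 1) (k : Fin n) (φ : (Fin (k : ℕ) → B) → B → ℝ) :
    ∑ z, causalProd c z * φ (past z k) (z k) =
      ∑ z, causalProd c z * ∑ b, c k (past z k) b * φ (past z k) b := by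
  induction n with
  | zero => exact k.elim0
  | succ n ih =>
    rw [sum_eq_sum_snoc, sum_eq_sum_snoc]
    induction k using Fin.lastCases with
    | last =>
      refine Finset.sum_congr rfl fun h _ => ?_
      simp only [causalProd_snoc, past_snoc_last, Fin.snoc_last]
      rw [← Finset.sum_mul, ← Finset.mul_sum, hc, mul_one, Finset.mul_sum]
      exact Finset.sum_congr rfl fun b _ => by ring
    | cast k =>
      simp only [causalProd_snoc, past_snoc_castSucc, Fin.snoc_castSucc, mul_right_comm _ (c _ _ _),
        ← Finset.mul_sum, hc, mul_one]
      exact ih (fun k h => hc k.castSucc h) k φ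

lemma sum_prod_eq_one {p : B → ℝ} (hp : ∑ b, p b = 1) : ∑ z : Fin n → B, ∏ k, p (z k) = 1 :=
  sum_causalProd (c := fun _ _ => p) fun _ _ => hp

/-- The `k`-th letter of an i.i.d. sequence has the common law. -/
lemma sum_prod_mul_apply {p : B → ℝ} (hp : ∑ b, p b = 1) (k : Fin n) (φ : B → ℝ) :
    ∑ z : Fin n → B, (∏ j, p (z j)) * φ (z k) = ∑ b, p b * φ b := by
  have := sum_causalProd_mul (c := fun _ _ => p) (fun _ _ => hp) k fun _ => φ
  refine this.trans ?_
  rw [← Finset.sum_mul, sum_causalProd fun _ _ => hp, one_mul]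

end Causal

/-! ### Entropy as an expectation -/

section Entropy

variable {Ω Ω' α β γ : Type*} [Fintype Ω] [Fintype Ω'] [Fintype α] [Fintype β] [Fintype γ]

lemma law_nonneg {μ : Ω → ℝ} (hμ : ∀ ω, 0 ≤ μ ω) {α : Type*} (X : Ω → α) (a : α) :
    0 ≤ law μ X a :=
  Finset.sum_nonneg fun ω _ => by split_ifs <;> simp [hμ ω]

lemma le_law {μ : Ω → ℝ} (hμ : ∀ ω, 0 ≤ μ ω) {α : Type*} (X : Ω → α) (ω : Ω) :
    μ ω ≤ law μ X (X ω) := by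
  classical
  have := Finset.single_le_sum (f := fun ω' => if X ω' = X ω then μ ω' else 0)
    (fun ω' _ => by split_ifs <;> simp [hμ ω']) (Finset.mem_univ ω)
  simpa [law] using this

lemma law_pos {μ : Ω → ℝ} (hμ : ∀ ω, 0 ≤ μ ω) {α : Type*} (X : Ω → α) {ω : Ω} (h : 0 < μ ω) :
    0 < law μ X (X ω) := h.trans_le (le_law hμ X ω)

lemma sum_law_mul (μ : Ω → ℝ) (X : Ω → α) (φ : α → ℝ) :
    ∑ a, law μ X a * φ a = ∑ ω, μ ω * φ (X ω) := by
  classical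
  simp only [law, Finset.sum_mul]
  rw [Finset.sum_comm]
  refine Finset.sum_congr rfl fun ω _ => ?_
  simp

lemma sum_law (μ : Ω → ℝ) (X : Ω → α) : ∑ a, law μ X a = ∑ ω, μ ω := by
  simpa using sum_law_mul μ X 1

lemma law_congr (μ : Ω → ℝ) {α β : Type*} {X : Ω → α} {X' : Ω → β} {ω₀ : Ω}
    (h : ∀ ω, X ω = X ω₀ ↔ X' ω = X' ω₀) : law μ X (X ω₀) = law μ X' (X' ω₀) := by
  classical
  exact Finset.sum_congr rfl fun ω _ => if_congr (h ω) rfl rfl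

lemma entropy_mul_log_two (μ : Ω → ℝ) (X : Ω → α) :
    entropy μ X * Real.log 2 = -∑ ω, μ ω * Real.log (law μ X (X ω)) := by
  rw [entropy, div_mul_cancel₀ _ (Real.log_pos one_lt_two).ne',
    ← sum_law_mul μ X fun a => Real.log (law μ X a), ← Finset.sum_neg_distrib]
  exact Finset.sum_congr rfl fun a _ => by rw [Real.negMulLog]; ring

lemma condEntropy_mul_log_two (μ : Ω → ℝ) (X : Ω → α) (Z : Ω → γ) :
    condEntropy μ X Z * Real.log 2 = ∑ ω, μ ω * (Real.log (law μ Z (Z ω)) -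
      Real.log (law μ (fun ω => (X ω, Z ω)) (X ω, Z ω))) := by
  rw [condEntropy, sub_mul, entropy_mul_log_two, entropy_mul_log_two]
  simp only [mul_sub, Finset.sum_sub_distrib]
  ring

lemma entropy_congr (μ : Ω → ℝ) {X : Ω → α} {X' : Ω → β}
    (h : ∀ ω ω', X ω = X ω' ↔ X' ω = X' ω') : entropy μ X = entropy μ X' := by
  refine mul_right_cancel₀ (Real.log_pos one_lt_two).ne' ?_
  rw [entropy_mul_log_two, entropy_mul_log_two]
  simp only [fun ω => law_congr μ (ω₀ := ω) fun ω' => h ω' ω]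

lemma condEntropy_congr (μ : Ω → ℝ) {δ : Type*} [Fintype δ] {X : Ω → α} {X' : Ω → β} {Z : Ω → γ}
    {Z' : Ω → δ} (h : ∀ ω ω', X ω = X ω' ↔ X' ω = X' ω') (hZ : ∀ ω ω', Z ω = Z ω' ↔ Z' ω = Z' ω') :
    condEntropy μ X Z = condEntropy μ X' Z' := by
  unfold condEntropy
  rw [entropy_congr μ hZ, entropy_congr μ (X := fun ω => (X ω, Z ω)) (X' := fun ω => (X' ω, Z' ω))]
  simp [h, hZ]

lemma entropy_comp_equiv (e : Ω' ≃ Ω) (μ : Ω → ℝ) (X : Ω → α) :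
    entropy (fun ω => μ (e ω)) (fun ω => X (e ω)) = entropy μ X := by
  have : law (fun ω => μ (e ω)) (fun ω => X (e ω)) = law μ X := by
    funext a
    exact e.sum_comp fun ω => open Classical in if X ω = a then μ ω else 0
  rw [entropy, entropy, this]

lemma condEntropy_comp_equiv (e : Ω' ≃ Ω) (μ : Ω → ℝ) (X : Ω → α) (Z : Ω → γ) :
    condEntropy (fun ω => μ (e ω)) (fun ω => X (e ω)) (fun ω => Z (e ω)) = condEntropy μ X Z := by
  unfold condEntropy
  rw [entropy_comp_equiv e μ Z, ← entropy_comp_equiv e μ fun ω => (X ω, Z ω)]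

/-- If `c` is a version of the conditional probability of `X` given `Z`, then `H(X|Z)` is the
expectation of `-log c`. -/
lemma condEntropy_mul_log_two_of_law_eq {μ : Ω → ℝ} (hμ : ∀ ω, 0 ≤ μ ω) {X : Ω → α} {Z : Ω → γ}
    {c : Ω → ℝ} (hc : ∀ ω, 0 < μ ω → law μ (fun ω => (X ω, Z ω)) (X ω, Z ω) = law μ Z (Z ω) * c ω) :
    condEntropy μ X Z * Real.log 2 = -∑ ω, μ ω * Real.log (c ω) := by
  rw [condEntropy_mul_log_two, ← Finset.sum_neg_distrib]
  refine Finset.sum_congr rfl fun ω _ => ?_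
  rcases (hμ ω).eq_or_lt with h | h
  · simp [← h]
  · have h1 := law_pos hμ (fun ω => (X ω, Z ω)) h
    have h2 := law_pos hμ Z h
    have h3 : c ω ≠ 0 := fun h0 => by simp [hc ω h, h0] at h1
    rw [hc ω h, Real.log_mul h2.ne' h3]
    ring

/-- The entropy of a triple whose components are driven by the index `q` of a mixture, by a
variable independent of the mixture, and by the mixed variable. -/
lemma entropy_mixture {Q A B : Type*} [Fintype Q] [Fintype A] [Fintype B] {pQ : Q → ℝ}
    {a : A → ℝ} {R : Q → B → ℝ} (ha : ∑ x, a x = 1) (hR : ∀ q, ∑ b, R q b = 1) (σ : A → α)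
    (v : B → β) :
    entropy (fun ω : Q × A × B => pQ ω.1 * a ω.2.1 * R ω.1 ω.2.2)
        (fun ω => (σ ω.2.1, v ω.2.2, ω.1)) =
      (∑ q, Real.negMulLog (pQ q)) / Real.log 2 + (∑ q, pQ q) * entropy a σ +
        ∑ q, pQ q * entropy (R q) v := by
  classical
  have hl : ∀ s t q, law (fun ω : Q × A × B => pQ ω.1 * a ω.2.1 * R ω.1 ω.2.2)
      (fun ω => (σ ω.2.1, v ω.2.2, ω.1)) (s, t, q) = pQ q * (law a σ s * law (R q) v t) := by
    intro s t q
    simp only [law, Fintype.sum_prod_type, Prod.mk.injEq]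
    rw [Finset.sum_mul_sum, Finset.mul_sum, Finset.sum_eq_single q]
    · refine Finset.sum_congr rfl fun x _ => ?_
      rw [Finset.mul_sum]
      refine Finset.sum_congr rfl fun b _ => ?_
      by_cases h1 : σ x = s <;> by_cases h2 : v b = t <;> simp [h1, h2, mul_assoc]
    · intro q' _ hq'
      simp [hq']
    · simp
  have ha' : ∑ s, law a σ s = 1 := by rw [sum_law, ha]
  have hR' : ∀ q, ∑ t, law (R q) v t = 1 := fun q => by rw [sum_law, hR]
  have hq : ∀ q, ∑ s, ∑ t, Real.negMulLog (pQ q * (law a σ s * law (R q) v t)) =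
      Real.negMulLog (pQ q) + pQ q * ∑ s, Real.negMulLog (law a σ s) +
        pQ q * ∑ t, Real.negMulLog (law (R q) v t) := by
    intro q
    have : ∀ s t, Real.negMulLog (pQ q * (law a σ s * law (R q) v t)) =
        law a σ s * (law (R q) v t * Real.negMulLog (pQ q)) +
        law (R q) v t * (pQ q * Real.negMulLog (law a σ s)) +
        law a σ s * (pQ q * Real.negMulLog (law (R q) v t)) := by
      intro s t
      rw [Real.negMulLog_mul, Real.negMulLog_mul]
      ring
    simp only [this, Finset.sum_add_distrib, ← Finset.mul_sum, ← Finset.sum_mul, hR', ha', one_mul]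
  simp only [entropy, Fintype.sum_prod_type, hl]
  have : ∑ s, ∑ t, ∑ q, Real.negMulLog (pQ q * (law a σ s * law (R q) v t)) =
      ∑ q, ∑ s, ∑ t, Real.negMulLog (pQ q * (law a σ s * law (R q) v t)) := by
    rw [Finset.sum_congr rfl fun s _ => Finset.sum_comm, Finset.sum_comm]
  rw [this]
  simp only [hq, Finset.sum_add_distrib, add_div, Finset.sum_div, Finset.sum_mul, mul_div_assoc]

/-- `H(X|Z)` for a mixture is the average of the conditional entropies of its constituents. -/
lemma condEntropy_mixture {Q A B : Type*} [Fintype Q] [Fintype A] [Fintype B] {pQ : Q → ℝ}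
    {a : A → ℝ} {R : Q → B → ℝ} (ha : ∑ x, a x = 1) (hR : ∀ q, ∑ b, R q b = 1) (σ : A → α)
    (u : B → γ) (v : B → β) :
    condEntropy (fun ω : Q × A × B => pQ ω.1 * a ω.2.1 * R ω.1 ω.2.2)
        (fun ω => u ω.2.2) (fun ω => (σ ω.2.1, v ω.2.2, ω.1)) =
      ∑ q, pQ q * condEntropy (R q) u v := by
  unfold condEntropy
  rw [entropy_mixture ha hR, entropy_congr _ (X' := fun ω : Q × A × B =>
    (σ ω.2.1, (u ω.2.2, v ω.2.2), ω.1)), entropy_mixture ha hR σ fun b => (u b, v b)]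
  · simp only [mul_sub, Finset.sum_sub_distrib]
    ring
  · intro ω ω'
    simp only [Prod.mk.injEq]
    tauto

end Entropy

/-! ### The single-letter bounds -/

section Gain

variable {X Y Y₃ : Type*} [Fintype Y] [Fintype Y₃] {ch : X → Y × Y₃ → ℝ}

/-- The marginal channel to the destination. -/
def destChannel {Y₃ : Type*} [Fintype Y₃] (ch : X → Y × Y₃ → ℝ) (x : X) (y : Y) : ℝ :=
  ∑ y₃, ch x (y, y₃)

/-- The joint p.m.f. of the input and the destination output when the input has p.m.f. `P`. -/
def inOutLaw (ch : X → Y × Y₃ → ℝ) (P : X → ℝ) : X × Y → ℝ :=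
  fun b => P b.1 * destChannel ch b.1 b.2

/-- The mutual information `I(X;Y|V)` for a channel input `X` with p.m.f. `P` and `V` a function
of `X`. -/
def gain {β : Type*} [Fintype X] [Fintype β] (ch : X → Y × Y₃ → ℝ) (P : X → ℝ) (v : X → β) : ℝ :=
  condEntropy (inOutLaw ch P) Prod.snd (fun b => v b.1) -
    condEntropy (inOutLaw ch P) Prod.snd Prod.fst

lemma sum_destChannel (hch : ∀ x, ch x ∈ stdSimplex ℝ (Y × Y₃)) (x : X) :
    ∑ y, destChannel ch x y = 1 := by
  simp only [destChannel, ← Fintype.sum_prod_type', (hch x).2]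

lemma destChannel_nonneg (hch : ∀ x, ch x ∈ stdSimplex ℝ (Y × Y₃)) (x : X) (y : Y) :
    0 ≤ destChannel ch x y :=
  Finset.sum_nonneg fun _ _ => (hch x).1 _

lemma sum_inOutLaw [Fintype X] (hch : ∀ x, ch x ∈ stdSimplex ℝ (Y × Y₃))
    {P : X → ℝ} (hP : ∑ x, P x = 1) : ∑ b, inOutLaw ch P b = 1 := by
  simp only [inOutLaw, Fintype.sum_prod_type (α₁ := X), ← Finset.mul_sum,
    sum_destChannel hch, mul_one, hP]

end Gain

section JointLaw

variable {S₁ S₂ W W₃ X₁ X₂ X₃ Y Y₃ : Type*}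

/-- The regrouping of the variables of the joint law into time-sharing variable, source variables
and channel variables. -/
def regroup {Q : Type*} :
    Q × S₁ × S₂ × W × X₁ × X₂ × X₃ × Y ≃ Q × (S₁ × S₂ × W) × (X₁ × X₂ × X₃) × Y where
  toFun := fun (q, s₁, s₂, w, x₁, x₂, x₃, y) => (q, (s₁, s₂, w), (x₁, x₂, x₃), y)
  invFun := fun (q, (s₁, s₂, w), (x₁, x₂, x₃), y) => (q, s₁, s₂, w, x₁, x₂, x₃, y)
  left_inv := fun _ => rfl
  right_inv := fun _ => rfl

variable [Fintype S₁] [Fintype S₂] [Fintype W] [Fintype W₃]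
  [Fintype X₁] [Fintype X₂] [Fintype X₃] [Fintype Y] [Fintype Y₃]
  {Q : Type*} [Fintype Q] {src : S₁ × S₂ × W × W₃ → ℝ}
  {ch : X₁ × X₂ × X₃ → Y × Y₃ → ℝ} {pQ : Q → ℝ} {κ : Q → S₁ × S₂ → X₁ × X₂ → ℝ}
  {r : X₁ × X₂ × S₁ × S₂ × Q → X₃ → ℝ} {P : Q → X₁ × X₂ × X₃ → ℝ}

/-- When the channel inputs are independent of the sources given `q`, conditioning `Y` on a function
of the sources, next to `q` and a function of the inputs, has no effect. -/
lemma condEntropy_jointLaw (hsrc : src ∈ stdSimplex ℝ (S₁ × S₂ × W × W₃))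
    (hch : ∀ x, ch x ∈ stdSimplex ℝ (Y × Y₃)) (hP : ∀ q, ∑ x, P q x = 1)
    (hκr : ∀ q s₁ s₂ x₁ x₂ x₃,
      κ q (s₁, s₂) (x₁, x₂) * r (x₁, x₂, s₁, s₂, q) x₃ = P q (x₁, x₂, x₃))
    {α β γ : Type*} [Fintype α] [Fintype β] [Fintype γ]
    (σ : S₁ × S₂ × W → α) (v : X₁ × X₂ × X₃ → β)
    {Z : Q × S₁ × S₂ × W × X₁ × X₂ × X₃ × Y → γ}
    (hZ : ∀ ω ω', Z ω = Z ω' ↔ (σ (regroup ω).2.1, v (regroup ω).2.2.1, (regroup ω).1) =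
        (σ (regroup ω').2.1, v (regroup ω').2.2.1, (regroup ω').1)) :
    condEntropy (jointLaw src ch pQ κ r) (fun (_, _, _, _, _, _, _, y) => y) Z =
      ∑ q, pQ q * condEntropy (inOutLaw ch (P q)) Prod.snd (fun b => v b.1) := by
  set a : S₁ × S₂ × W → ℝ := fun u => ∑ w₃, src (u.1, u.2.1, u.2.2, w₃) with ha
  have ha1 : ∑ u, a u = 1 := by
    rw [← hsrc.2]
    simp only [ha, Fintype.sum_prod_type]
  have hμ : jointLaw src ch pQ κ r = fun ω =>
      (fun ω' : Q × (S₁ × S₂ × W) × (X₁ × X₂ × X₃) × Y =>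
        pQ ω'.1 * a ω'.2.1 * inOutLaw ch (P ω'.1) ω'.2.2) (regroup ω) := by
    funext ⟨q, s₁, s₂, w, x₁, x₂, x₃, y⟩
    simp only [jointLaw, inOutLaw, destChannel, regroup, Equiv.coe_fn_mk, ← hκr q s₁ s₂, ha]
    ring
  refine (condEntropy_congr _ (X' := fun ω => (regroup ω).2.2.2) (fun _ _ => Iff.rfl) hZ).trans ?_
  rw [hμ, condEntropy_comp_equiv regroup (fun ω' : Q × (S₁ × S₂ × W) × (X₁ × X₂ × X₃) × Y =>
      pQ ω'.1 * a ω'.2.1 * inOutLaw ch (P ω'.1) ω'.2.2) (fun ω => ω.2.2.2)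
      (fun ω => (σ ω.2.1, v ω.2.2.1, ω.1))]
  exact condEntropy_mixture ha1 (fun q => sum_inOutLaw hch (hP q)) σ Prod.snd fun b => v b.1

lemma macConstraints_jointLaw (hsrc : src ∈ stdSimplex ℝ (S₁ × S₂ × W × W₃))
    (hch : ∀ x, ch x ∈ stdSimplex ℝ (Y × Y₃)) (hP : ∀ q, ∑ x, P q x = 1)
    (hκr : ∀ q s₁ s₂ x₁ x₂ x₃,
      κ q (s₁, s₂) (x₁, x₂) * r (x₁, x₂, s₁, s₂, q) x₃ = P q (x₁, x₂, x₃)) {ε : ℝ}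
    (h1 : condEntropy src (fun u => u.1) (fun u => (u.2.1, u.2.2.1)) ≤
      ∑ q, pQ q * gain ch (P q) (fun x => x.2.1) + ε)
    (h2 : condEntropy src (fun u => u.2.1) (fun u => (u.1, u.2.2.1)) ≤
      ∑ q, pQ q * gain ch (P q) (fun x => x.1) + ε)
    (h3 : condEntropy src (fun u => (u.1, u.2.1)) (fun u => u.2.2.1) ≤
      ∑ q, pQ q * gain ch (P q) (fun _ => ()) + ε) :
    MACConstraints src (jointLaw src ch pQ κ r) ε := by
  simp only [gain, mul_sub, Finset.sum_sub_distrib] at h1 h2 h3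
  refine ⟨h1.trans_eq ?_, h2.trans_eq ?_, h3.trans_eq ?_⟩
  · rw [condMutualInfo, condEntropy_jointLaw hsrc hch hP hκr (fun u => (u.2.1, u.2.2))
      (fun x => x.2.1), condEntropy_jointLaw hsrc hch hP hκr (fun u => (u.2.1, u.2.2))
      (fun x => x)]
    · rintro ⟨q, s₁, s₂, w, x₁, x₂, x₃, y⟩ ⟨q', s₁', s₂', w', x₁', x₂', x₃', y'⟩
      simp only [regroup, Equiv.coe_fn_mk, Prod.mk.injEq]
      tauto
    · rintro ⟨q, s₁, s₂, w, x₁, x₂, x₃, y⟩ ⟨q', s₁', s₂', w', x₁', x₂', x₃', y'⟩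
      simp only [regroup, Equiv.coe_fn_mk, Prod.mk.injEq]
      tauto
  · rw [condMutualInfo, condEntropy_jointLaw hsrc hch hP hκr (fun u => (u.1, u.2.2))
      (fun x => x.1), condEntropy_jointLaw hsrc hch hP hκr (fun u => (u.1, u.2.2))
      (fun x => x)]
    · rintro ⟨q, s₁, s₂, w, x₁, x₂, x₃, y⟩ ⟨q', s₁', s₂', w', x₁', x₂', x₃', y'⟩
      simp only [regroup, Equiv.coe_fn_mk, Prod.mk.injEq]
      tauto
    · rintro ⟨q, s₁, s₂, w, x₁, x₂, x₃, y⟩ ⟨q', s₁', s₂', w', x₁', x₂', x₃', y'⟩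
      simp only [regroup, Equiv.coe_fn_mk, Prod.mk.injEq]
      tauto
  · rw [condMutualInfo, condEntropy_jointLaw hsrc hch hP hκr (fun u => u.2.2)
      (fun _ => ()), condEntropy_jointLaw hsrc hch hP hκr (fun u => u.2.2)
      (fun x => x)]
    · rintro ⟨q, s₁, s₂, w, x₁, x₂, x₃, y⟩ ⟨q', s₁', s₂', w', x₁', x₂', x₃', y'⟩
      simp only [regroup, Equiv.coe_fn_mk, Prod.mk.injEq]
      tauto
    · rintro ⟨q, s₁, s₂, w, x₁, x₂, x₃, y⟩ ⟨q', s₁', s₂', w', x₁', x₂', x₃', y'⟩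
      simp only [regroup, Equiv.coe_fn_mk, Prod.mk.injEq]
      tauto

end JointLaw

/-! ### The one-shot converse -/

section Converse

variable {U X Y Y₃ : Type*} {n : ℕ}

/-- The joint law of an i.i.d. sequence `u` and of the outputs of a memoryless channel whose `k`-th
input is a function `x u k` of `u` and of the past channel outputs. -/
def seqLaw (p : U → ℝ) (ch : X → Y × Y₃ → ℝ)
    (x : (Fin n → U) → (k : Fin n) → (Fin (k : ℕ) → Y × Y₃) → X) :
    (Fin n → U) × (Fin n → Y × Y₃) → ℝ :=
  fun ω => (∏ k, p (ω.1 k)) * causalProd (fun k h => ch (x ω.1 k h)) ω.2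

variable [Fintype U] [Fintype Y] [Fintype Y₃]

/-- The law of the `k`-th channel input. -/
def inputLaw (p : U → ℝ) (ch : X → Y × Y₃ → ℝ)
    (x : (Fin n → U) → (k : Fin n) → (Fin (k : ℕ) → Y × Y₃) → X) (k : Fin n) : X → ℝ :=
  law (seqLaw p ch x) fun ω => x ω.1 k (past ω.2 k)

lemma law_prod {α : Type*} (g : U → ℝ) (f : U → α) (s : Fin n → α) :
    law (fun u : Fin n → U => ∏ k, g (u k)) (fun u k => f (u k)) s = ∏ k, law g f (s k) := by
  classical
  simp only [law]
  rw [Finset.prod_univ_sum, Fintype.piFinset_univ]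
  refine Finset.sum_congr rfl fun u _ => ?_
  rw [Finset.prod_ite_zero]
  simp [funext_iff]

variable {p : U → ℝ} {ch : X → Y × Y₃ → ℝ}
  {x : (Fin n → U) → (k : Fin n) → (Fin (k : ℕ) → Y × Y₃) → X}

lemma seqLaw_nonneg (hp : p ∈ stdSimplex ℝ U) (hch : ∀ x, ch x ∈ stdSimplex ℝ (Y × Y₃))
    (ω : (Fin n → U) × (Fin n → Y × Y₃)) : 0 ≤ seqLaw p ch x ω :=
  mul_nonneg (Finset.prod_nonneg fun _ _ => hp.1 _)
    (causalProd_nonneg (fun _ _ => (hch _).1) _)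

lemma sum_seqLaw_mul_fst (hch : ∀ x, ch x ∈ stdSimplex ℝ (Y × Y₃)) (φ : (Fin n → U) → ℝ) :
    ∑ ω, seqLaw p ch x ω * φ ω.1 = ∑ u : Fin n → U, (∏ k, p (u k)) * φ u := by
  simp only [seqLaw]
  rw [Fintype.sum_prod_type]
  refine Finset.sum_congr rfl fun u _ => ?_
  dsimp only
  rw [← Finset.sum_mul, ← Finset.mul_sum, sum_causalProd fun _ _ => (hch _).2, mul_one]

lemma sum_seqLaw (hp : p ∈ stdSimplex ℝ U) (hch : ∀ x, ch x ∈ stdSimplex ℝ (Y × Y₃)) :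
    ∑ ω, seqLaw p ch x ω = 1 := by
  have := sum_seqLaw_mul_fst (x := x) (p := p) hch 1
  simpa [sum_prod_eq_one hp.2] using this

/-- By causality and memorylessness, the `k`-th channel input and output are distributed as an input
from `inputLaw` and the corresponding output. -/
lemma sum_seqLaw_mul_inOut [Fintype X] (hch : ∀ x, ch x ∈ stdSimplex ℝ (Y × Y₃)) (k : Fin n)
    (φ : X → Y → ℝ) :
    ∑ ω, seqLaw p ch x ω * φ (x ω.1 k (past ω.2 k)) (ω.2 k).1 =
      ∑ b, inOutLaw ch (inputLaw p ch x k) b * φ b.1 b.2 := by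
  have h1 : ∑ ω, seqLaw p ch x ω * φ (x ω.1 k (past ω.2 k)) (ω.2 k).1 =
      ∑ ω, seqLaw p ch x ω * ∑ y, destChannel ch (x ω.1 k (past ω.2 k)) y *
        φ (x ω.1 k (past ω.2 k)) y := by
    simp only [seqLaw]
    rw [Fintype.sum_prod_type, Fintype.sum_prod_type]
    refine Finset.sum_congr rfl fun u _ => ?_
    simp only [mul_assoc, ← Finset.mul_sum]
    rw [sum_causalProd_mul (fun _ _ => (hch _).2) k fun h b => φ (x u k h) b.1]
    simp only [Fintype.sum_prod_type, ← Finset.sum_mul, destChannel]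
  rw [h1, ← sum_law_mul (seqLaw p ch x) (fun ω => x ω.1 k (past ω.2 k))
    fun x => ∑ y, destChannel ch x y * φ x y, Fintype.sum_prod_type]
  refine Finset.sum_congr rfl fun x' _ => ?_
  rw [Finset.mul_sum]
  exact Finset.sum_congr rfl fun y _ => by simp only [inOutLaw, inputLaw]; ring

/-- The conditional probability of `X = a` given `Z = c`; it is `0` if `Z = c` has probability `0`. -/
def condProb {Ω α γ : Type*} [Fintype Ω] (μ : Ω → ℝ) (X : Ω → α) (Z : Ω → γ) (a : α) (c : γ) : ℝ :=
  law μ (fun ω => (X ω, Z ω)) (a, c) / law μ Z c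

lemma condProb_nonneg {Ω α γ : Type*} [Fintype Ω] {μ : Ω → ℝ} (hμ : ∀ ω, 0 ≤ μ ω) (X : Ω → α)
    (Z : Ω → γ) (a : α) (c : γ) : 0 ≤ condProb μ X Z a c :=
  div_nonneg (law_nonneg hμ _ _) (law_nonneg hμ _ _)

lemma condProb_pos {Ω α γ : Type*} [Fintype Ω] {μ : Ω → ℝ} (hμ : ∀ ω, 0 ≤ μ ω) (X : Ω → α)
    (Z : Ω → γ) {ω : Ω} (h : 0 < μ ω) : 0 < condProb μ X Z (X ω) (Z ω) :=
  div_pos (law_pos hμ (fun ω => (X ω, Z ω)) h) (law_pos hμ Z h)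

lemma sum_law_pair {Ω α γ : Type*} [Fintype Ω] [Fintype α] (μ : Ω → ℝ) (X : Ω → α)
    (Z : Ω → γ) (c : γ) : ∑ a, law μ (fun ω => (X ω, Z ω)) (a, c) = law μ Z c := by
  classical
  simp only [law, Prod.mk.injEq]
  rw [Finset.sum_comm]
  refine Finset.sum_congr rfl fun ω _ => ?_
  by_cases h : Z ω = c <;> simp [h]

lemma sum_condProb_le {Ω α γ : Type*} [Fintype Ω] [Fintype α] (μ : Ω → ℝ) (X : Ω → α)
    (Z : Ω → γ) (c : γ) : ∑ a, condProb μ X Z a c ≤ 1 := by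
  simp only [condProb]
  rw [← Finset.sum_div, sum_law_pair]
  exact div_self_le_one _

lemma condEntropy_mul_log_two_eq_condProb {Ω α γ : Type*} [Fintype Ω] [Fintype α] [Fintype γ]
    {μ : Ω → ℝ} (hμ : ∀ ω, 0 ≤ μ ω) (X : Ω → α) (Z : Ω → γ) :
    condEntropy μ X Z * Real.log 2 = -∑ ω, μ ω * Real.log (condProb μ X Z (X ω) (Z ω)) :=
  condEntropy_mul_log_two_of_law_eq hμ fun _ h => (mul_div_cancel₀ _ (law_pos hμ Z h).ne').symm

lemma inOutLaw_nonneg (hch : ∀ x, ch x ∈ stdSimplex ℝ (Y × Y₃)) {P : X → ℝ} (hP : ∀ x, 0 ≤ P x)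
    (b : X × Y) : 0 ≤ inOutLaw ch P b :=
  mul_nonneg (hP _) (destChannel_nonneg hch _ _)

lemma condEntropy_inOutLaw_fst [Fintype X] (hch : ∀ x, ch x ∈ stdSimplex ℝ (Y × Y₃)) {P : X → ℝ}
    (hP : ∀ x, 0 ≤ P x) : condEntropy (inOutLaw ch P) Prod.snd Prod.fst * Real.log 2 =
      -∑ b, inOutLaw ch P b * Real.log (destChannel ch b.1 b.2) := by
  classical
  refine condEntropy_mul_log_two_of_law_eq (inOutLaw_nonneg hch hP) fun b _ => ?_
  have h1 : law (inOutLaw ch P) Prod.fst b.1 = P b.1 := by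
    simp only [law, Fintype.sum_prod_type]
    rw [Finset.sum_eq_single b.1]
    · simp [inOutLaw, ← Finset.mul_sum, sum_destChannel hch]
    · intro x' _ hx'
      simp [hx']
    · simp
  have h2 : law (inOutLaw ch P) (fun b => (b.2, b.1)) (b.2, b.1) = inOutLaw ch P b := by
    simp only [law]
    rw [Finset.sum_eq_single b]
    · simp
    · intro b' _ hb'
      rw [if_neg]
      simpa [Prod.ext_iff, and_comm] using hb'
    · simp
  rw [h1, h2, inOutLaw]

variable {τ ζ β : Type*}

/-- The conditional sub-probability underlying Fano's inequality: mass `1/2` on the estimate `t₀`,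
and mass `1/2` divided by the alphabet size on every other letter. -/
def fanoWeight [Fintype τ] (t₀ t : τ) : ℝ :=
  open Classical in if t₀ ≠ t then (2 * (Fintype.card τ : ℝ))⁻¹ else 2⁻¹

lemma fanoWeight_pos [Fintype τ] (t₀ t : τ) : 0 < fanoWeight t₀ t := by
  have : Nonempty τ := ⟨t⟩
  have := Fintype.card_pos (α := τ)
  unfold fanoWeight
  split_ifs <;> positivity

lemma sum_fanoWeight_le [Fintype τ] (t₀ : τ) : ∑ t, fanoWeight t₀ t ≤ 1 := by
  classical
  have : Nonempty τ := ⟨t₀⟩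
  have hc : (0 : ℝ) < Fintype.card τ := by exact_mod_cast Fintype.card_pos (α := τ)
  have h : ∀ t, fanoWeight t₀ t ≤ (2 * (Fintype.card τ : ℝ))⁻¹ + if t₀ = t then 2⁻¹ else 0 := by
    intro t
    unfold fanoWeight
    by_cases ht : t₀ = t
    · simp [ht]
    · simp [ht]
  refine (Finset.sum_le_sum fun t _ => h t).trans_eq ?_
  rw [Finset.sum_add_distrib, Finset.sum_const, Finset.card_univ, nsmul_eq_mul,
    Finset.sum_ite_eq, if_pos (Finset.mem_univ _)]
  field_simp
  norm_num

variable [Fintype τ] [Fintype ζ] [Fintype β]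

/-- The expected likelihood ratio of the one-shot converse is at most one. -/
lemma sum_seqLaw_mul_ratio_le (hp : p ∈ stdSimplex ℝ U) (hch : ∀ x, ch x ∈ stdSimplex ℝ (Y × Y₃))
    (T : U → τ) (Z : U → ζ) (D : Fin n → (Fin n → ζ) → Y → ℝ) (hD0 : ∀ k z y, 0 ≤ D k z y)
    (hD : ∀ k z, ∑ y, D k z y ≤ 1) (g : (Fin n → Y) → (Fin n → ζ) → (Fin n → τ)) :
    ∑ ω, seqLaw p ch x ω *
      (fanoWeight (g (fun k => (ω.2 k).1) fun k => Z (ω.1 k)) (fun k => T (ω.1 k)) *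
        (∏ k, D k (fun k => Z (ω.1 k)) (ω.2 k).1) *
        (∏ k, condProb p T Z (T (ω.1 k)) (Z (ω.1 k)))⁻¹ *
        (∏ k, destChannel ch (x ω.1 k (past ω.2 k)) (ω.2 k).1)⁻¹) ≤ 1 := by
  set Φ : (Fin n → τ) → (Fin n → ζ) → (Fin n → Y) → ℝ := fun t z y =>
    fanoWeight (g y z) t * ∏ k, D k z (y k) with hΦ
  have hΦ0 : ∀ t z y, 0 ≤ Φ t z y := fun t z y =>
    mul_nonneg (fanoWeight_pos _ _).le (Finset.prod_nonneg fun _ _ => hD0 _ _ _)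
  have hΦ1 : ∀ z, ∑ t, ∑ y, Φ t z y ≤ 1 := by
    intro z
    rw [Finset.sum_comm]
    simp only [hΦ, ← Finset.sum_mul]
    calc ∑ y, (∑ t, fanoWeight (g y z) t) * ∏ k, D k z (y k)
        ≤ ∑ y : Fin n → Y, ∏ k, D k z (y k) := Finset.sum_le_sum fun y _ =>
          mul_le_of_le_one_left (Finset.prod_nonneg fun _ _ => hD0 _ _ _) (sum_fanoWeight_le _)
      _ = ∏ k, ∑ y, D k z y := by
          classical
          rw [Finset.prod_univ_sum, Fintype.piFinset_univ]
      _ ≤ 1 := Finset.prod_le_one (fun k _ => Finset.sum_nonneg fun _ _ => hD0 _ _ _)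
          fun k _ => hD k z
  -- The sum over the relay outputs of the conditional law given the destination outputs.
  have hrelay : ∀ (u : Fin n → U) (y : Fin n → Y), ∑ y₃ : Fin n → Y₃,
      causalProd (fun k h => ch (x u k h)) (fun k => (y k, y₃ k)) *
        (∏ k, destChannel ch (x u k (past (fun k => (y k, y₃ k)) k)) (y k))⁻¹ ≤ 1 := by
    intro u y
    have := sum_causalProd_le (B := Y₃) (n := n)
      (c := fun k h b => ch (x u k fun j => (y (Fin.castLE k.isLt.le j), h j)) (y k, b) *
        (destChannel ch (x u k fun j => (y (Fin.castLE k.isLt.le j), h j)) (y k))⁻¹)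
      (fun k h b => mul_nonneg ((hch _).1 _) (inv_nonneg.2 (destChannel_nonneg hch _ _)))
      (fun k h => by
        rw [← Finset.sum_mul]
        exact mul_inv_le_one)
    refine le_of_eq_of_le (Finset.sum_congr rfl fun y₃ _ => ?_) this
    rw [causalProd, causalProd, Finset.prod_mul_distrib, Finset.prod_inv_distrib]
    rfl
  have h1 : ∀ u : Fin n → U, ∑ v : Fin n → Y × Y₃, causalProd (fun k h => ch (x u k h)) v *
      (Φ (fun k => T (u k)) (fun k => Z (u k)) (fun k => (v k).1) *
        (∏ k, destChannel ch (x u k (past v k)) (v k).1)⁻¹) ≤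
      ∑ y, Φ (fun k => T (u k)) (fun k => Z (u k)) y := by
    intro u
    rw [← (Equiv.arrowProdEquivProdArrow (Fin n) (fun _ => Y) (fun _ => Y₃)).symm.sum_comp,
      Fintype.sum_prod_type]
    refine Finset.sum_le_sum fun y _ => ?_
    refine le_trans (le_of_eq ?_) (mul_le_of_le_one_right (hΦ0 _ _ y) (hrelay u y))
    rw [Finset.mul_sum]
    refine Finset.sum_congr rfl fun y₃ _ => ?_
    simp only [Equiv.arrowProdEquivProdArrow, Equiv.coe_fn_symm_mk]
    ring
  -- Weighting by the inverse of the conditional probability of `T` given `Z` turns the law of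
  -- `(T,Z)` into the law of `Z` alone, counted once for every value of `T` in the support.
  set G : U → ℝ := fun u => p u * (condProb p T Z (T u) (Z u))⁻¹ with hG
  have hG0 : ∀ u, 0 ≤ G u := fun u =>
    mul_nonneg (hp.1 u) (inv_nonneg.2 (condProb_nonneg hp.1 _ _ _ _))
  have hGlaw : ∀ s : τ × ζ, law G (fun u => (T u, Z u)) s ≤ law p Z s.2 := by
    intro s
    have : law G (fun u => (T u, Z u)) s =
        law p (fun u => (T u, Z u)) s * (condProb p T Z s.1 s.2)⁻¹ := by
      classical
      simp only [law, Finset.sum_mul, hG]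
      refine Finset.sum_congr rfl fun u _ => ?_
      split_ifs with h
      · rw [← h]
      · rw [zero_mul]
    rw [this, condProb, inv_div, mul_div_assoc', mul_comm, ← mul_div_assoc']
    exact mul_le_of_le_one_right (law_nonneg hp.1 _ _) (div_self_le_one _)
  calc _ = ∑ u : Fin n → U, (∏ k, G (u k)) * ∑ v : Fin n → Y × Y₃,
        causalProd (fun k h => ch (x u k h)) v *
          (Φ (fun k => T (u k)) (fun k => Z (u k)) (fun k => (v k).1) *
        (∏ k, destChannel ch (x u k (past v k)) (v k).1)⁻¹) := by
        rw [Fintype.sum_prod_type]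
        refine Finset.sum_congr rfl fun u _ => ?_
        rw [Finset.mul_sum]
        refine Finset.sum_congr rfl fun v _ => ?_
        simp only [seqLaw, hΦ, hG, Finset.prod_mul_distrib, Finset.prod_inv_distrib]
        ring
    _ ≤ ∑ u : Fin n → U, (∏ k, G (u k)) * ∑ y, Φ (fun k => T (u k)) (fun k => Z (u k)) y :=
        Finset.sum_le_sum fun u _ => mul_le_mul_of_nonneg_left (h1 u)
          (Finset.prod_nonneg fun _ _ => hG0 _)
    _ = ∑ s : Fin n → τ × ζ, (∏ k, law G (fun u => (T u, Z u)) (s k)) *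
          ∑ y, Φ (fun k => (s k).1) (fun k => (s k).2) y := by
        rw [← sum_law_mul (fun u : Fin n → U => ∏ k, G (u k)) (fun u k => (T (u k), Z (u k)))
          fun s => ∑ y, Φ (fun k => (s k).1) (fun k => (s k).2) y]
        exact Finset.sum_congr rfl fun s _ => by
          rw [law_prod G (fun u => (T u, Z u)) s]
    _ ≤ ∑ s : Fin n → τ × ζ, (∏ k, law p Z (s k).2) *
          ∑ y, Φ (fun k => (s k).1) (fun k => (s k).2) y := by
        refine Finset.sum_le_sum fun s _ => mul_le_mul_of_nonneg_right ?_
          (Finset.sum_nonneg fun _ _ => hΦ0 _ _ _)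
        exact Finset.prod_le_prod (fun k _ => law_nonneg hG0 _ _) fun k _ => hGlaw _
    _ = ∑ z : Fin n → ζ, (∏ k, law p Z (z k)) * ∑ t, ∑ y, Φ t z y := by
        rw [← (Equiv.arrowProdEquivProdArrow (Fin n) (fun _ => τ) (fun _ => ζ)).symm.sum_comp,
          Fintype.sum_prod_type, Finset.sum_comm]
        refine Finset.sum_congr rfl fun z _ => ?_
        rw [Finset.mul_sum]
        rfl
    _ ≤ ∑ z : Fin n → ζ, ∏ k, law p Z (z k) :=
        Finset.sum_le_sum fun z _ => mul_le_of_le_one_right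
          (Finset.prod_nonneg fun _ _ => law_nonneg hp.1 _ _) (hΦ1 z)
    _ = 1 := sum_prod_eq_one (by rw [sum_law, hp.2])

/-- Converse for a block code: if the decoder recovers `T` from the channel outputs and the side
information `Z`, then the conditional entropy of `T` given `Z` is covered, up to a Fano term, by the
gains at the individual times. Here `V` is a function of the channel inputs that is determined by
the side information. -/
theorem oneShot_converse [Fintype X] (hp : p ∈ stdSimplex ℝ U)
    (hch : ∀ x, ch x ∈ stdSimplex ℝ (Y × Y₃))
    (T : U → τ) (Z : U → ζ) (v : X → β) (V : Fin n → (Fin n → ζ) → β)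
    (hV : ∀ u k h, v (x u k h) = V k fun j => Z (u j))
    (g : (Fin n → Y) → (Fin n → ζ) → (Fin n → τ)) {Pe : ℝ}
    (hPe : ∑ ω, Set.indicator {ω : (Fin n → U) × (Fin n → Y × Y₃) |
      g (fun k => (ω.2 k).1) (fun k => Z (ω.1 k)) ≠ fun k => T (ω.1 k)} (seqLaw p ch x) ω ≤ Pe) :
    n * condEntropy p T Z * Real.log 2 ≤
      Real.log 2 + Pe * (n * Real.log (Fintype.card τ)) +
        (∑ k, gain ch (inputLaw p ch x k) v) * Real.log 2 := by
  classical
  set μ := seqLaw p ch x with hμ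
  have hμ0 : ∀ ω, 0 ≤ μ ω := seqLaw_nonneg hp hch
  have hμ1 : ∑ ω, μ ω = 1 := sum_seqLaw hp hch
  set R : Fin n → X × Y → ℝ := fun k => inOutLaw ch (inputLaw p ch x k) with hR
  have hP0 : ∀ k x', 0 ≤ inputLaw p ch x k x' := fun k x' => law_nonneg hμ0 _ _
  have hR0 : ∀ k b, 0 ≤ R k b := fun k b => inOutLaw_nonneg hch (hP0 k) b
  set d : Fin n → β → Y → ℝ := fun k b y => condProb (R k) Prod.snd (fun b => v b.1) y b with hd
  set F : (Fin n → U) × (Fin n → Y × Y₃) → ℝ := fun ω =>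
    fanoWeight (g (fun k => (ω.2 k).1) fun k => Z (ω.1 k)) (fun k => T (ω.1 k)) with hF
  have hratio := sum_seqLaw_mul_ratio_le (x := x) hp hch T Z (fun k z y => d k (V k z) y)
    (fun k z y => condProb_nonneg (hR0 k) _ _ _ _) (fun k z => sum_condProb_le _ _ _ _) g
  have hlog : ∑ ω, μ ω * (Real.log (F ω) + ∑ k, Real.log (d k (v (x ω.1 k (past ω.2 k))) (ω.2 k).1)
      - ∑ k, Real.log (condProb p T Z (T (ω.1 k)) (Z (ω.1 k)))
      - ∑ k, Real.log (destChannel ch (x ω.1 k (past ω.2 k)) (ω.2 k).1)) ≤ 0 := by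
    have : ∀ ω, μ ω * (Real.log (F ω) + ∑ k, Real.log (d k (v (x ω.1 k (past ω.2 k))) (ω.2 k).1)
        - ∑ k, Real.log (condProb p T Z (T (ω.1 k)) (Z (ω.1 k)))
        - ∑ k, Real.log (destChannel ch (x ω.1 k (past ω.2 k)) (ω.2 k).1)) ≤
        μ ω * (F ω * (∏ k, d k (V k fun k => Z (ω.1 k)) (ω.2 k).1) *
          (∏ k, condProb p T Z (T (ω.1 k)) (Z (ω.1 k)))⁻¹ *
          (∏ k, destChannel ch (x ω.1 k (past ω.2 k)) (ω.2 k).1)⁻¹) - μ ω := by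
      intro ω
      rcases (hμ0 ω).eq_or_lt with h | h
      · simp [← h]
      -- On the support of the law all factors of the ratio are positive, so its logarithm splits.
      have hpu : ∀ k, 0 < p (ω.1 k) := fun k => (hp.1 _).lt_of_ne fun h0 => by
        rw [hμ, seqLaw, Finset.prod_eq_zero (Finset.mem_univ k) h0.symm, zero_mul] at h
        exact h.false
      have hchk : ∀ k, 0 < ch (x ω.1 k (past ω.2 k)) (ω.2 k) := fun k =>
        ((hch _).1 _).lt_of_ne fun h0 => by
          have h0' : causalProd (fun k h => ch (x ω.1 k h)) ω.2 = 0 :=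
            Finset.prod_eq_zero (Finset.mem_univ k) h0.symm
          rw [hμ, seqLaw, h0', mul_zero] at h
          exact h.false
      have hW : ∀ k, 0 < destChannel ch (x ω.1 k (past ω.2 k)) (ω.2 k).1 := fun k =>
        (hchk k).trans_le (Finset.single_le_sum (f := fun y₃ => ch (x ω.1 k (past ω.2 k))
          ((ω.2 k).1, y₃)) (fun _ _ => (hch _).1 _) (Finset.mem_univ (ω.2 k).2))
      have ha : ∀ k, 0 < condProb p T Z (T (ω.1 k)) (Z (ω.1 k)) := fun k =>
        condProb_pos hp.1 T Z (hpu k)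
      have hdk : ∀ k, 0 < d k (v (x ω.1 k (past ω.2 k))) (ω.2 k).1 := fun k =>
        condProb_pos (hR0 k) Prod.snd (fun b => v b.1) (ω := (x ω.1 k (past ω.2 k), (ω.2 k).1))
          (mul_pos (law_pos hμ0 (fun ω => x ω.1 k (past ω.2 k)) h) (hW k))
      rw [← mul_sub_one]
      refine mul_le_mul_of_nonneg_left ?_ h.le
      simp only [← hV ω.1 _ (past ω.2 _)]
      have pF : 0 < F ω := fanoWeight_pos _ _
      have pd := Finset.prod_pos fun k (_ : k ∈ Finset.univ) => hdk k
      have pa := Finset.prod_pos fun k (_ : k ∈ Finset.univ) => ha k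
      have pW := Finset.prod_pos fun k (_ : k ∈ Finset.univ) => hW k
      refine le_trans (le_of_eq ?_) (Real.log_le_sub_one_of_pos (by positivity))
      rw [Real.log_mul (by positivity) (by positivity), Real.log_mul (by positivity) (by positivity),
        Real.log_mul (by positivity) (by positivity), Real.log_inv, Real.log_inv,
        Real.log_prod fun k _ => (hdk k).ne', Real.log_prod fun k _ => (ha k).ne',
        Real.log_prod fun k _ => (hW k).ne']
      ring
    refine (Finset.sum_le_sum fun ω _ => this ω).trans ?_
    rw [Finset.sum_sub_distrib, hμ1]
    linarith
  simp only [mul_sub, mul_add, Finset.sum_sub_distrib, Finset.sum_add_distrib, Finset.mul_sum]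
    at hlog
  rw [Finset.sum_comm (f := fun ω k => μ ω * Real.log (d k _ _)),
    Finset.sum_comm (f := fun ω k => μ ω * Real.log (condProb p T Z _ _)),
    Finset.sum_comm (f := fun ω k => μ ω * Real.log (destChannel ch _ _))] at hlog
  have eT : ∀ k, ∑ ω, μ ω * Real.log (condProb p T Z (T (ω.1 k)) (Z (ω.1 k))) =
      -(condEntropy p T Z * Real.log 2) := by
    intro k
    rw [condEntropy_mul_log_two_eq_condProb hp.1, neg_neg, hμ,
      sum_seqLaw_mul_fst hch fun u => Real.log (condProb p T Z (T (u k)) (Z (u k))),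
      sum_prod_mul_apply hp.2 k fun u => Real.log (condProb p T Z (T u) (Z u))]
  have eD : ∀ k, ∑ ω, μ ω * Real.log (d k (v (x ω.1 k (past ω.2 k))) (ω.2 k).1) =
      -(condEntropy (R k) Prod.snd (fun b => v b.1) * Real.log 2) := by
    intro k
    rw [condEntropy_mul_log_two_eq_condProb (hR0 k), neg_neg, hμ,
      sum_seqLaw_mul_inOut hch k fun x' y => Real.log (d k (v x') y)]
  have eW : ∀ k, ∑ ω, μ ω * Real.log (destChannel ch (x ω.1 k (past ω.2 k)) (ω.2 k).1) =
      -(condEntropy (R k) Prod.snd Prod.fst * Real.log 2) := by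
    intro k
    rw [condEntropy_inOutLaw_fst hch (hP0 k), neg_neg, hμ,
      sum_seqLaw_mul_inOut hch k fun x' y => Real.log (destChannel ch x' y)]
  have eF : -(Real.log 2 + Pe * (n * Real.log (Fintype.card τ))) ≤
      ∑ ω, μ ω * Real.log (F ω) := by
    have hM : 0 ≤ n * Real.log (Fintype.card τ) :=
      mul_nonneg (Nat.cast_nonneg _) (Real.log_natCast_nonneg _)
    have : ∀ ω, μ ω * Real.log (F ω) = -(μ ω * Real.log 2) -
        Set.indicator {ω : (Fin n → U) × (Fin n → Y × Y₃) |
          g (fun k => (ω.2 k).1) (fun k => Z (ω.1 k)) ≠ fun k => T (ω.1 k)} μ ω *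
          (n * Real.log (Fintype.card τ)) := by
      intro ω
      have hne : (Fintype.card (Fin n → τ) : ℝ) ≠ 0 := by
        have : Nonempty (Fin n → τ) := ⟨fun k => T (ω.1 k)⟩
        exact_mod_cast Fintype.card_ne_zero
      simp only [hF, fanoWeight, Set.indicator_apply, Set.mem_ofPred_eq]
      by_cases hg : g (fun k => (ω.2 k).1) (fun k => Z (ω.1 k)) = fun k => T (ω.1 k)
      · rw [if_neg (not_not.2 hg), if_neg (not_not.2 hg), Real.log_inv]
        ring
      · rw [if_pos hg, if_pos hg]
        rw [Real.log_inv, Real.log_mul two_ne_zero hne, Fintype.card_fun, Fintype.card_fin,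
          Nat.cast_pow, Real.log_pow]
        ring
    simp only [this, Finset.sum_sub_distrib, Finset.sum_neg_distrib, ← Finset.sum_mul, hμ1]
    have := mul_le_mul_of_nonneg_right hPe hM
    linarith
  simp only [eT, eD, eW, Finset.sum_neg_distrib, Finset.sum_const, Finset.card_univ,
    Fintype.card_fin, nsmul_eq_mul, ← Finset.sum_mul] at hlog
  simp only [gain, Finset.sum_sub_distrib, sub_mul]
  linarith

end Converse

/-! ### Block codes for the relay channel -/

section Codes

variable {S₁ S₂ W W₃ X₁ X₂ X₃ Y Y₃ : Type*} {n : ℕ}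

/-- The triple of channel inputs at time `k` produced by the code `c`, as a function of the source
sequences `u` and the past channel outputs `h`. -/
def Code.inputs (c : Code S₁ S₂ W W₃ X₁ X₂ X₃ Y Y₃ n) (u : Fin n → S₁ × S₂ × W × W₃) (k : Fin n)
    (h : Fin (k : ℕ) → Y × Y₃) : X₁ × X₂ × X₃ :=
  (c.f₁ (fun j => (u j).1) k, c.f₂ (fun j => (u j).2.1) k,
    c.f₃ k (fun j => (h j).2) fun j => (u j).2.2.2)

lemma sum_arrow_prod {α β : Type*} [Fintype α] [Fintype β] (φ : (Fin n → α × β) → ℝ) :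
    ∑ z, φ z = ∑ a : Fin n → α, ∑ b : Fin n → β, φ fun k => (a k, b k) := by
  rw [← (Equiv.arrowProdEquivProdArrow (Fin n) (fun _ => α) (fun _ => β)).symm.sum_comp,
    Fintype.sum_prod_type]
  rfl

variable [Fintype S₁] [Fintype S₂] [Fintype W] [Fintype W₃] [Fintype Y] [Fintype Y₃]
  {src : S₁ × S₂ × W × W₃ → ℝ} {ch : X₁ × X₂ × X₃ → Y × Y₃ → ℝ}

lemma errorProb_eq (c : Code S₁ S₂ W W₃ X₁ X₂ X₃ Y Y₃ n) :
    errorProb src ch c = open Classical in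
      ∑ ω, if c.g (fun k => (ω.2 k).1) (fun k => (ω.1 k).2.2.1) ≠
        (fun k => (ω.1 k).1, fun k => (ω.1 k).2.1) then seqLaw src ch c.inputs ω else 0 := by
  simp only [Fintype.sum_prod_type, sum_arrow_prod]
  rfl

lemma errorProb_nonneg (hsrc : src ∈ stdSimplex ℝ (S₁ × S₂ × W × W₃))
    (hch : ∀ x, ch x ∈ stdSimplex ℝ (Y × Y₃)) (c : Code S₁ S₂ W W₃ X₁ X₂ X₃ Y Y₃ n) :
    0 ≤ errorProb src ch c := by
  rw [errorProb_eq]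
  refine Finset.sum_nonneg fun ω _ => ?_
  split_ifs
  · exact seqLaw_nonneg hsrc hch ω
  · exact le_rfl

/-- An estimate that is correct whenever the decoder is correct errs with at most the error
probability of the code. -/
lemma sum_ite_ne_le_errorProb (hsrc : src ∈ stdSimplex ℝ (S₁ × S₂ × W × W₃))
    (hch : ∀ x, ch x ∈ stdSimplex ℝ (Y × Y₃)) (c : Code S₁ S₂ W W₃ X₁ X₂ X₃ Y Y₃ n) {α : Type*}
    {a b : (Fin n → S₁ × S₂ × W × W₃) × (Fin n → Y × Y₃) → α}
    (h : ∀ ω, c.g (fun k => (ω.2 k).1) (fun k => (ω.1 k).2.2.1) =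
      (fun k => (ω.1 k).1, fun k => (ω.1 k).2.1) → a ω = b ω) :
    ∑ ω, Set.indicator {ω | a ω ≠ b ω} (seqLaw src ch c.inputs) ω ≤ errorProb src ch c := by
  classical
  rw [errorProb_eq]
  refine Finset.sum_le_sum fun ω _ => ?_
  have h0 := seqLaw_nonneg (x := c.inputs) hsrc hch ω
  by_cases hA : a ω = b ω
  · rw [Set.indicator_of_notMem (show ω ∉ {ω | a ω ≠ b ω} from not_not.2 hA)]
    split_ifs
    · exact h0
    · exact le_rfl
  · rw [Set.indicator_of_mem (show ω ∈ {ω | a ω ≠ b ω} from hA), if_pos fun hg => hA (h ω hg)]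

lemma sourcePair_eq_law : sourcePair src = law src fun u => (u.1, u.2.1) := by
  classical
  funext s
  simp only [law, Fintype.sum_prod_type, sourcePair]
  rw [Finset.sum_eq_single s.1, Finset.sum_eq_single s.2]
  · simp
  · intro s₂ _ h
    simp [Prod.ext_iff, h]
  · simp
  · intro s₁ _ h
    simp [Prod.ext_iff, h]
  · simp

lemma sourcePair_mem (hsrc : src ∈ stdSimplex ℝ (S₁ × S₂ × W × W₃)) :
    sourcePair src ∈ stdSimplex ℝ (S₁ × S₂) := by
  rw [sourcePair_eq_law]
  exact ⟨fun _ => law_nonneg hsrc.1 _ _, by rw [sum_law, hsrc.2]⟩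

lemma inputLaw_mem {U X : Type*} [Fintype U] [Fintype X] {p : U → ℝ} {ch : X → Y × Y₃ → ℝ}
    {x : (Fin n → U) → (k : Fin n) → (Fin (k : ℕ) → Y × Y₃) → X} (hp : p ∈ stdSimplex ℝ U)
    (hch : ∀ x, ch x ∈ stdSimplex ℝ (Y × Y₃)) (k : Fin n) :
    inputLaw p ch x k ∈ stdSimplex ℝ X :=
  ⟨fun _ => law_nonneg (seqLaw_nonneg hp hch) _ _, by
    rw [inputLaw, sum_law, sum_seqLaw hp hch]⟩

variable [Fintype X₁] [Fintype X₂] [Fintype X₃]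

/-- The first two inputs of the channel are functions of the two source sequences. -/
lemma sum_inputLaw (hch : ∀ x, ch x ∈ stdSimplex ℝ (Y × Y₃))
    (c : Code S₁ S₂ W W₃ X₁ X₂ X₃ Y Y₃ n) (k : Fin n) (x₁ : X₁) (x₂ : X₂) :
    ∑ x₃, inputLaw src ch c.inputs k (x₁, x₂, x₃) = open Classical in
      ∑ t₁ : Fin n → S₁, ∑ t₂ : Fin n → S₂, (if c.f₁ t₁ k = x₁ then 1 else 0) *
        (if c.f₂ t₂ k = x₂ then 1 else 0) * ∏ j, sourcePair src (t₁ j, t₂ j) := by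
  classical
  have h1 : ∑ x₃, inputLaw src ch c.inputs k (x₁, x₂, x₃) =
      ∑ x, inputLaw src ch c.inputs k x *
        ((if x.1 = x₁ then 1 else 0) * (if x.2.1 = x₂ then 1 else 0)) := by
    rw [Fintype.sum_prod_type, Finset.sum_eq_single x₁, Fintype.sum_prod_type,
      Finset.sum_eq_single x₂]
    · simp
    · intro x _ h
      simp [h]
    · simp
    · intro x _ h
      simp [h]
    · simp
  rw [h1, inputLaw, sum_law_mul]
  refine (sum_seqLaw_mul_fst (x := c.inputs) hch fun u =>
      (if c.f₁ (fun j => (u j).1) k = x₁ then 1 else 0) *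
        (if c.f₂ (fun j => (u j).2.1) k = x₂ then 1 else 0)).trans ?_
  rw [← sum_law_mul (fun u : Fin n → S₁ × S₂ × W × W₃ => ∏ k, src (u k))
      (fun u k => ((u k).1, (u k).2.1)) fun s : Fin n → S₁ × S₂ =>
        (if c.f₁ (fun j => (s j).1) k = x₁ then 1 else 0) *
        (if c.f₂ (fun j => (s j).2) k = x₂ then 1 else 0), sum_arrow_prod]
  refine Finset.sum_congr rfl fun t₁ _ => Finset.sum_congr rfl fun t₂ _ => ?_
  rw [law_prod src (fun u => (u.1, u.2.1)), ← sourcePair_eq_law, mul_comm]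

lemma sum_marginal_mem {P : X₁ × X₂ × X₃ → ℝ} (hP : P ∈ stdSimplex ℝ (X₁ × X₂ × X₃)) :
    (fun x : X₁ × X₂ => ∑ x₃, P (x.1, x.2, x₃)) ∈ stdSimplex ℝ (X₁ × X₂) := by
  refine ⟨fun _ => Finset.sum_nonneg fun _ _ => hP.1 _, ?_⟩
  rw [← hP.2]
  simp only [Fintype.sum_prod_type]

/-- The law of the channel inputs `(X₁,X₂)` of a code at time `k`, regarded as a conditional law
given a source pair independent of the code, is in the Markov set: the source letters after the
first one are used as the source block of the code. -/
lemma const_mem_markovSet (hsrc : src ∈ stdSimplex ℝ (S₁ × S₂ × W × W₃))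
    (hch : ∀ x, ch x ∈ stdSimplex ℝ (Y × Y₃)) (c : Code S₁ S₂ W W₃ X₁ X₂ X₃ Y Y₃ n) (k : Fin n) :
    (fun _ x => ∑ x₃, inputLaw src ch c.inputs k (x.1, x.2, x₃)) ∈
      markovSet X₁ X₂ (sourcePair src) := by
  classical
  refine ⟨fun _ => sum_marginal_mem (inputLaw_mem hsrc hch k), n,
    fun t x₁ => if c.f₁ (Fin.tail t) k = x₁ then 1 else 0,
    fun t x₂ => if c.f₂ (Fin.tail t) k = x₂ then 1 else 0, fun t => ?_, fun t => ?_, ?_⟩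
  · exact ⟨fun _ => by dsimp only; split_ifs <;> simp, by simp⟩
  · exact ⟨fun _ => by dsimp only; split_ifs <;> simp, by simp⟩
  · intro s₁ s₂ x₁ x₂ hs
    simp only [Fin.tail_cons, Fin.prod_univ_succ, Fin.cons_zero, Fin.cons_succ]
    rw [sum_inputLaw hch c k x₁ x₂, eq_inv_mul_iff_mul_eq₀ hs, Finset.mul_sum]
    refine Finset.sum_congr rfl fun t₁ _ => ?_
    rw [Finset.mul_sum]
    exact Finset.sum_congr rfl fun t₂ _ => by ring

/-- A conditional p.m.f. of the third component; where the first two have probability `0` it is a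
point mass. -/
lemma exists_conditional {X₁ X₂ X₃ : Type*} [Fintype X₃] [Nonempty X₃]
    {P : X₁ × X₂ × X₃ → ℝ} (hP : ∀ x, 0 ≤ P x) :
    ∃ r : X₁ × X₂ → X₃ → ℝ, (∀ x, r x ∈ stdSimplex ℝ X₃) ∧
      ∀ x₁ x₂ x₃, (∑ x, P (x₁, x₂, x)) * r (x₁, x₂) x₃ = P (x₁, x₂, x₃) := by
  classical
  obtain ⟨x₀⟩ := ‹Nonempty X₃›
  refine ⟨fun x => if ∑ x₃, P (x.1, x.2, x₃) = 0 then Pi.single x₀ 1 else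
    fun x₃ => P (x.1, x.2, x₃) / ∑ x₃, P (x.1, x.2, x₃), fun x => ?_, fun x₁ x₂ x₃ => ?_⟩
  · dsimp only
    split_ifs with h
    · exact single_mem_stdSimplex ℝ x₀
    · exact ⟨fun _ => div_nonneg (hP _) (Finset.sum_nonneg fun _ _ => hP _), by
        rw [← Finset.sum_div, div_self h]⟩
  · dsimp only
    split_ifs with h
    · rw [h, zero_mul]
      exact ((Finset.sum_eq_zero_iff_of_nonneg fun _ _ => hP _).1 h x₃ (Finset.mem_univ _)).symm
    · exact mul_div_cancel₀ _ h

lemma log_card_le_log_card_prod {α β : Type*} [Fintype α] [Fintype β] [Nonempty α] [Nonempty β] :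
    Real.log (Fintype.card α) ≤ Real.log (Fintype.card (α × β)) := by
  have h1 : 0 < Fintype.card α := Fintype.card_pos
  have h2 : 0 < Fintype.card β := Fintype.card_pos
  refine Real.log_le_log (by exact_mod_cast h1) ?_
  rw [Fintype.card_prod]
  exact_mod_cast Nat.le_mul_of_pos_right _ h2

/-- The three converse bounds for a block code. -/
lemma code_converse (hsrc : src ∈ stdSimplex ℝ (S₁ × S₂ × W × W₃))
    (hch : ∀ x, ch x ∈ stdSimplex ℝ (Y × Y₃)) (c : Code S₁ S₂ W W₃ X₁ X₂ X₃ Y Y₃ n) :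
    n * condEntropy src (fun u => u.1) (fun u => (u.2.1, u.2.2.1)) * Real.log 2 ≤
      Real.log 2 + errorProb src ch c * (n * Real.log (Fintype.card (S₁ × S₂))) +
        (∑ k, gain ch (inputLaw src ch c.inputs k) fun x => x.2.1) * Real.log 2 ∧
    n * condEntropy src (fun u => u.2.1) (fun u => (u.1, u.2.2.1)) * Real.log 2 ≤
      Real.log 2 + errorProb src ch c * (n * Real.log (Fintype.card (S₁ × S₂))) +
        (∑ k, gain ch (inputLaw src ch c.inputs k) fun x => x.1) * Real.log 2 ∧
    n * condEntropy src (fun u => (u.1, u.2.1)) (fun u => u.2.2.1) * Real.log 2 ≤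
      Real.log 2 + errorProb src ch c * (n * Real.log (Fintype.card (S₁ × S₂))) +
        (∑ k, gain ch (inputLaw src ch c.inputs k) fun _ => ()) * Real.log 2 := by
  classical
  have hne : Nonempty (S₁ × S₂ × W × W₃) := by
    by_contra h
    rw [not_nonempty_iff] at h
    simpa using hsrc.2
  have hS₁ : Nonempty S₁ := hne.map fun u => u.1
  have hS₂ : Nonempty S₂ := hne.map fun u => u.2.1
  have hl1 : Real.log (Fintype.card S₁) ≤ Real.log (Fintype.card (S₁ × S₂)) :=
    log_card_le_log_card_prod
  have hl2 : Real.log (Fintype.card S₂) ≤ Real.log (Fintype.card (S₁ × S₂)) := by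
    rw [Fintype.card_congr (Equiv.prodComm S₁ S₂)]
    exact log_card_le_log_card_prod
  refine ⟨?_, ?_, ?_⟩
  · refine (oneShot_converse (x := c.inputs) (Pe := errorProb src ch c) hsrc hch (fun u => u.1)
      (fun u => (u.2.1, u.2.2.1)) (fun x : X₁ × X₂ × X₃ => x.2.1)
      (fun k z => c.f₂ (fun j => (z j).1) k) (fun u k h => rfl)
      (fun y z => (c.g y fun j => (z j).2).1) ?_).trans ?_
    · exact sum_ite_ne_le_errorProb hsrc hch c fun ω h => by dsimp only; rw [h]
    · have := errorProb_nonneg hsrc hch c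
      gcongr
  · refine (oneShot_converse (x := c.inputs) (Pe := errorProb src ch c) hsrc hch (fun u => u.2.1)
      (fun u => (u.1, u.2.2.1)) (fun x : X₁ × X₂ × X₃ => x.1)
      (fun k z => c.f₁ (fun j => (z j).1) k) (fun u k h => rfl)
      (fun y z => (c.g y fun j => (z j).2).2) ?_).trans ?_
    · exact sum_ite_ne_le_errorProb hsrc hch c fun ω h => by dsimp only; rw [h]
    · have := errorProb_nonneg hsrc hch c
      gcongr
  · refine oneShot_converse (x := c.inputs) (Pe := errorProb src ch c) hsrc hch
      (fun u => (u.1, u.2.1)) (fun u => u.2.2.1) (fun _ : X₁ × X₂ × X₃ => ())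
      (fun _ _ => ()) (fun u k h => rfl)
      (fun y z k => ((c.g y z).1 k, (c.g y z).2 k)) ?_
    exact sum_ite_ne_le_errorProb hsrc hch c fun ω h => by rw [h]

end Codes

/-! ### Time sharing and compactness -/

section TimeSharing

/-- Carathéodory's theorem for a finite family of points in `ℝ^d`, with a fixed number `d + 1` of
(possibly repeated) points. -/
lemma exists_fin_convex_combination {ι : Type*} [Fintype ι] {d : ℕ} (z : ι → Fin d → ℝ)
    {c : ι → ℝ} (hc : c ∈ stdSimplex ℝ ι) :
    ∃ w ∈ stdSimplex ℝ (Fin (d + 1)), ∃ f : Fin (d + 1) → ι,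
      ∀ i, ∑ q, w q * z (f q) i = ∑ j, c j * z j i := by
  classical
  have hmem : ∑ j, c j • z j ∈ convexHull ℝ (Set.range z) :=
    (convex_convexHull ℝ _).sum_mem (fun j _ => hc.1 j) hc.2
      fun j _ => subset_convexHull ℝ _ ⟨j, rfl⟩
  obtain ⟨κ, _, y, w, hy, hind, hw0, hw1, hsum⟩ := eq_pos_convex_span_of_mem_convexHull hmem
  have hcard : Fintype.card κ ≤ d + 1 := by
    have := hind.card_le_finrank_succ
    refine this.trans (Nat.succ_le_succ ?_)
    refine (Submodule.finrank_le _).trans ?_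
    simp
  choose g hg using fun a => hy ⟨a, rfl⟩
  have e : κ ↪ Fin (d + 1) := by
    refine (Fintype.equivFin κ).toEmbedding.trans (Fin.castLEEmb hcard)
  have hκ : Nonempty κ := by
    by_contra h
    rw [not_nonempty_iff] at h
    simp at hw1
  -- The weights are transported along the embedding `e` and extended by zero.
  have key : ∀ φ : Fin (d + 1) → ℝ, ∑ q, (if h : ∃ a, e a = q then w h.choose else 0) * φ q =
      ∑ a, w a * φ (e a) := by
    intro φ
    have h1 : ∀ a, (if h : ∃ b, e b = e a then w h.choose else 0) = w a := by
      intro a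
      have h : ∃ b, e b = e a := ⟨a, rfl⟩
      rw [dif_pos h, e.injective h.choose_spec]
    rw [← Finset.sum_subset (Finset.subset_univ (Finset.univ.map e)), Finset.sum_map]
    · simp only [h1]
    · intro q _ hq
      rw [dif_neg, zero_mul]
      rintro ⟨a, ha⟩
      exact hq (by simp [← ha])
  refine ⟨fun q => if h : ∃ a, e a = q then w h.choose else 0, ⟨fun q => ?_, ?_⟩,
    fun q => g (Function.invFun e q), fun i => ?_⟩
  · dsimp only
    split_ifs
    · exact (hw0 _).le
    · exact le_rfl
  · simpa [hw1] using key 1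
  · rw [key fun q => z (g (Function.invFun e q)) i]
    have := congr_fun hsum i
    simp only [Finset.sum_apply, Pi.smul_apply, smul_eq_mul] at this
    rw [← this]
    exact Finset.sum_congr rfl fun a _ => by rw [Function.leftInverse_invFun e.injective a, hg]

variable {S₁ S₂ W W₃ X₁ X₂ X₃ Y Y₃ : Type*}
  [Fintype S₁] [Fintype S₂] [Fintype W] [Fintype W₃]
  [Fintype X₁] [Fintype X₂] [Fintype X₃] [Fintype Y] [Fintype Y₃]
  {src : S₁ × S₂ × W × W₃ → ℝ} {ch : X₁ × X₂ × X₃ → Y × Y₃ → ℝ}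

/-- The converse with slack `ε` and a time-sharing variable with four values. -/
lemma exists_jointLaw_of_reliablyTransmissible (hsrc : src ∈ stdSimplex ℝ (S₁ × S₂ × W × W₃))
    (hch : ∀ x, ch x ∈ stdSimplex ℝ (Y × Y₃)) (hrel : ReliablyTransmissible src ch) {ε : ℝ}
    (hε : 0 < ε) :
    ∃ (pQ : Fin 4 → ℝ) (κ : Fin 4 → S₁ × S₂ → X₁ × X₂ → ℝ)
      (r : X₁ × X₂ × S₁ × S₂ × Fin 4 → X₃ → ℝ),
      pQ ∈ stdSimplex ℝ (Fin 4) ∧ (∀ q, κ q ∈ markovSet X₁ X₂ (sourcePair src)) ∧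
      (∀ z, r z ∈ stdSimplex ℝ X₃) ∧ MACConstraints src (jointLaw src ch pQ κ r) ε := by
  obtain ⟨c, hc⟩ := hrel
  set l := Real.log (Fintype.card (S₁ × S₂)) with hl
  have hlog2 : 0 < Real.log 2 := Real.log_pos one_lt_two
  have hlim : Filter.Tendsto (fun n : ℕ => 1 / (n : ℝ) + errorProb src ch (c n) * (l / Real.log 2))
      Filter.atTop (𝓝 0) := by
    simpa using tendsto_one_div_atTop_nhds_zero_nat.add (hc.mul_const (l / Real.log 2))
  obtain ⟨n, hn, hn0⟩ := ((hlim.eventually_le_const hε).and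
    (Filter.eventually_gt_atTop 0)).exists
  have hnpos : (0 : ℝ) < n := Nat.cast_pos.2 hn0
  set P : Fin n → X₁ × X₂ × X₃ → ℝ := inputLaw src ch (c n).inputs with hP
  have hPmem : ∀ k, P k ∈ stdSimplex ℝ (X₁ × X₂ × X₃) := fun k => inputLaw_mem hsrc hch k
  -- The common form of the three bounds after division by the blocklength.
  have hdiv : ∀ {H : ℝ} {G : Fin n → ℝ},
      n * H * Real.log 2 ≤ Real.log 2 + errorProb src ch (c n) * (n * l) +
        (∑ k, G k) * Real.log 2 → H ≤ ∑ k, (n : ℝ)⁻¹ * G k + ε := by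
    intro H G h
    rw [← Finset.mul_sum]
    have h1 : H ≤ (n : ℝ)⁻¹ * ∑ k, G k + (1 / (n : ℝ) + errorProb src ch (c n) *
        (l / Real.log 2)) := by
      have : (n : ℝ)⁻¹ * ∑ k, G k + (1 / (n : ℝ) + errorProb src ch (c n) * (l / Real.log 2)) =
          (Real.log 2 + errorProb src ch (c n) * (n * l) + (∑ k, G k) * Real.log 2) /
            (n * Real.log 2) := by
        field_simp
        ring
      rw [this, le_div_iff₀ (mul_pos hnpos hlog2)]
      linarith
    linarith
  obtain ⟨h1, h2, h3⟩ := code_converse hsrc hch (c n)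
  obtain ⟨w, hw, f, hwf⟩ := exists_fin_convex_combination (d := 3)
    (fun k => ![gain ch (P k) fun x => x.2.1, gain ch (P k) fun x => x.1,
      gain ch (P k) fun _ => ()]) (c := fun _ : Fin n => (n : ℝ)⁻¹)
    ⟨fun _ => inv_nonneg.2 hnpos.le, by simp [hnpos.ne']⟩
  have hne : Nonempty (S₁ × S₂ × W × W₃) := by
    by_contra h
    rw [not_nonempty_iff] at h
    simpa using hsrc.2
  obtain ⟨u⟩ := hne
  -- The relay's input at time `0` is defined before any output, so its alphabet is nonempty.
  have hX₃ : Nonempty X₃ := ⟨(c n).f₃ ⟨0, hn0⟩ (fun j => j.elim0) fun _ => u.2.2.2⟩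
  choose r hr hrP using fun k => exists_conditional (hPmem k).1
  refine ⟨w, fun q _ x => ∑ x₃, P (f q) (x.1, x.2, x₃),
    fun z => r (f z.2.2.2.2) (z.1, z.2.1), hw, fun q => const_mem_markovSet hsrc hch (c n) (f q),
    fun z => hr _ _, ?_⟩
  refine macConstraints_jointLaw hsrc hch (P := fun q => P (f q)) (fun q => (hPmem _).2)
    (fun q _ _ x₁ x₂ x₃ => hrP (f q) x₁ x₂ x₃) ?_ ?_ ?_
  · exact (hdiv h1).trans_eq (congrArg (· + ε) (hwf 0).symm)
  · exact (hdiv h2).trans_eq (congrArg (· + ε) (hwf 1).symm)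
  · exact (hdiv h3).trans_eq (congrArg (· + ε) (hwf 2).symm)

lemma continuous_entropy {ι Ω α : Type*} [TopologicalSpace ι] [Fintype Ω] [Fintype α]
    {μ : ι → Ω → ℝ} (hμ : Continuous μ) (X : Ω → α) : Continuous fun i => entropy (μ i) X := by
  classical
  have h : ∀ a, Continuous fun i => law (μ i) X a := by
    intro a
    unfold law
    refine continuous_finsetSum _ fun ω _ => ?_
    split_ifs
    · exact (continuous_apply ω).comp hμ
    · exact continuous_const
  unfold entropy
  exact (continuous_finsetSum _ fun a _ => Real.continuous_negMulLog.comp (h a)).div_const _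

lemma continuous_condMutualInfo {ι Ω α β γ : Type*} [TopologicalSpace ι] [Fintype Ω] [Fintype α]
    [Fintype β] [Fintype γ] {μ : ι → Ω → ℝ} (hμ : Continuous μ) (X : Ω → α) (Y : Ω → β)
    (Z : Ω → γ) : Continuous fun i => condMutualInfo (μ i) X Y Z := by
  unfold condMutualInfo condEntropy
  exact ((continuous_entropy hμ _).sub (continuous_entropy hμ _)).sub
    ((continuous_entropy hμ _).sub (continuous_entropy hμ _))

lemma isClosed_macConstraints {ι Q : Type*} [TopologicalSpace ι] [Fintype Q]
    {μ : ι → Q × S₁ × S₂ × W × X₁ × X₂ × X₃ × Y → ℝ} (hμ : Continuous μ)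
    (src : S₁ × S₂ × W × W₃ → ℝ) (ε : ℝ) : IsClosed {i | MACConstraints src (μ i) ε} := by
  unfold MACConstraints
  exact (isClosed_le continuous_const ((continuous_condMutualInfo hμ _ _ _).add_const ε)).inter
    ((isClosed_le continuous_const ((continuous_condMutualInfo hμ _ _ _).add_const ε)).inter
      (isClosed_le continuous_const ((continuous_condMutualInfo hμ _ _ _).add_const ε)))

/-- The converse without slack, by compactness of the set of joint laws. -/
lemma exists_jointLaw_closure (hsrc : src ∈ stdSimplex ℝ (S₁ × S₂ × W × W₃))
    (hch : ∀ x, ch x ∈ stdSimplex ℝ (Y × Y₃)) (hrel : ReliablyTransmissible src ch) :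
    ∃ (pQ : Fin 4 → ℝ) (κ : Fin 4 → S₁ × S₂ → X₁ × X₂ → ℝ)
      (r : X₁ × X₂ × S₁ × S₂ × Fin 4 → X₃ → ℝ),
      pQ ∈ stdSimplex ℝ (Fin 4) ∧ (∀ q, κ q ∈ closure (markovSet X₁ X₂ (sourcePair src))) ∧
      (∀ z, r z ∈ stdSimplex ℝ X₃) ∧ MACConstraints src (jointLaw src ch pQ κ r) 0 := by
  set M := markovSet X₁ X₂ (sourcePair src) with hM
  set A : Set ((Fin 4 → ℝ) × (Fin 4 → S₁ × S₂ → X₁ × X₂ → ℝ) ×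
      (X₁ × X₂ × S₁ × S₂ × Fin 4 → X₃ → ℝ)) :=
    stdSimplex ℝ (Fin 4) ×ˢ ((Set.univ.pi fun _ => closure M) ×ˢ
      (Set.univ.pi fun _ => stdSimplex ℝ X₃)) with hA
  have hMc : IsCompact (closure M) := by
    refine IsCompact.of_isClosed_subset (isCompact_univ_pi fun _ : S₁ × S₂ =>
      isCompact_stdSimplex ℝ (X₁ × X₂)) isClosed_closure fun κ hκ s _ => ?_
    exact (closure_markovSet_subset_corrSet (sourcePair_mem hsrc) hκ).1 s
  have hAc : IsCompact A := (isCompact_stdSimplex ℝ (Fin 4)).prod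
    ((isCompact_univ_pi fun _ => hMc).prod (isCompact_univ_pi fun _ => isCompact_stdSimplex ℝ X₃))
  have hcont : Continuous fun t : (Fin 4 → ℝ) × (Fin 4 → S₁ × S₂ → X₁ × X₂ → ℝ) ×
      (X₁ × X₂ × S₁ × S₂ × Fin 4 → X₃ → ℝ) => jointLaw src ch t.1 t.2.1 t.2.2 := by
    refine continuous_pi fun ω => ?_
    obtain ⟨q, s₁, s₂, w, x₁, x₂, x₃, y⟩ := ω
    simp only [jointLaw]
    fun_prop
  set K : ℕ → Set ((Fin 4 → ℝ) × (Fin 4 → S₁ × S₂ → X₁ × X₂ → ℝ) ×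
      (X₁ × X₂ × S₁ × S₂ × Fin 4 → X₃ → ℝ)) := fun j =>
    A ∩ {t | MACConstraints src (jointLaw src ch t.1 t.2.1 t.2.2) (1 / ((j : ℝ) + 1))} with hK
  have hclosed : ∀ j, IsClosed (K j) := fun j =>
    hAc.isClosed.inter (isClosed_macConstraints hcont src _)
  obtain ⟨t, ht⟩ := IsCompact.nonempty_iInter_of_sequence_nonempty_isCompact_isClosed K
    (fun j t ht => ⟨ht.1, by
      have hj : 1 / (((j + 1 : ℕ) : ℝ) + 1) ≤ 1 / ((j : ℝ) + 1) :=
        one_div_le_one_div_of_le (by positivity) (by push_cast; linarith)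
      exact ⟨ht.2.1.trans (by gcongr), ht.2.2.1.trans (by gcongr), ht.2.2.2.trans (by gcongr)⟩⟩)
    (fun j => by
      obtain ⟨pQ, κ, r, h1, h2, h3, h4⟩ := exists_jointLaw_of_reliablyTransmissible hsrc hch hrel
        (ε := 1 / ((j : ℝ) + 1)) (by positivity)
      exact ⟨(pQ, κ, r), ⟨h1, fun q _ => subset_closure (h2 q), fun z _ => h3 z⟩, h4⟩)
    (hAc.of_isClosed_subset (hclosed 0) Set.inter_subset_left) hclosed
  rw [Set.mem_iInter] at ht
  refine ⟨t.1, t.2.1, t.2.2, (ht 0).1.1, fun q => (ht 0).1.2.1 q trivial,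
    fun z => (ht 0).1.2.2 z trivial, ?_⟩
  have hle : ∀ {a b : ℝ}, (∀ j : ℕ, a ≤ b + 1 / ((j : ℝ) + 1)) → a ≤ b + 0 := fun h =>
    ge_of_tendsto (tendsto_one_div_add_atTop_nhds_zero_nat.const_add _)
      (Filter.Eventually.of_forall h)
  exact ⟨hle fun j => (ht j).2.1, hle fun j => (ht j).2.2.1, hle fun j => (ht j).2.2.2⟩

end TimeSharing

end

end MARC

theorem mainTheorem2 {S₁ S₂ W W₃ X₁ X₂ X₃ Y Y₃ : Type*}
    [Fintype S₁] [Fintype S₂] [Fintype W] [Fintype W₃]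
    [Fintype X₁] [Fintype X₂] [Fintype X₃] [Fintype Y] [Fintype Y₃]
    (src : S₁ × S₂ × W × W₃ → ℝ) (hsrc : src ∈ stdSimplex ℝ (S₁ × S₂ × W × W₃))
    (ch : X₁ × X₂ × X₃ → Y × Y₃ → ℝ) (hch : ∀ x, ch x ∈ stdSimplex ℝ (Y × Y₃)) :
    MARC.markovSet X₁ X₂ (MARC.sourcePair src) ⊆ MARC.maxCorrSet X₁ X₂ (MARC.sourcePair src) ∧
    closure (MARC.markovSet X₁ X₂ (MARC.sourcePair src)) ⊆
      MARC.maxCorrSet X₁ X₂ (MARC.sourcePair src) ∧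
    (MARC.ReliablyTransmissible src ch →
      (∃ (N : ℕ) (pQ : Fin N → ℝ) (κ : Fin N → S₁ × S₂ → X₁ × X₂ → ℝ)
          (r : X₁ × X₂ × S₁ × S₂ × Fin N → X₃ → ℝ),
        N ≤ 4 ∧ pQ ∈ stdSimplex ℝ (Fin N) ∧
        (∀ q, κ q ∈ closure (MARC.markovSet X₁ X₂ (MARC.sourcePair src))) ∧
        (∀ z, r z ∈ stdSimplex ℝ X₃) ∧
        MARC.MACConstraints src (MARC.jointLaw src ch pQ κ r) 0) ∧
      (∀ ε : ℝ, 0 < ε →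
        ∃ (N : ℕ) (pQ : Fin N → ℝ) (κ : Fin N → S₁ × S₂ → X₁ × X₂ → ℝ)
          (r : X₁ × X₂ × S₁ × S₂ × Fin N → X₃ → ℝ),
        N ≤ 4 ∧ pQ ∈ stdSimplex ℝ (Fin N) ∧
        (∀ q, κ q ∈ MARC.markovSet X₁ X₂ (MARC.sourcePair src)) ∧
        (∀ z, r z ∈ stdSimplex ℝ X₃) ∧
        MARC.MACConstraints src (MARC.jointLaw src ch pQ κ r) ε)) := by
  have hpS := MARC.sourcePair_mem hsrc
  have hsub : MARC.corrSet X₁ X₂ (MARC.sourcePair src) (MARC.maxCorr (MARC.sourcePair src)) ⊆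
      MARC.maxCorrSet X₁ X₂ (MARC.sourcePair src) := MARC.corrSet_subset_maxCorrSet hpS.1
  refine ⟨(MARC.markovSet_subset_corrSet hpS).trans hsub,
    (MARC.closure_markovSet_subset_corrSet hpS).trans hsub, fun hrel => ⟨?_, fun ε hε => ?_⟩⟩
  · obtain ⟨pQ, κ, r, h⟩ := MARC.exists_jointLaw_closure hsrc hch hrel
    exact ⟨4, pQ, κ, r, le_rfl, h⟩
  · obtain ⟨pQ, κ, r, h⟩ := MARC.exists_jointLaw_of_reliablyTransmissible hsrc hch hrel hε
    exact ⟨4, pQ, κ, r, le_rfl, h⟩
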